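/- Let $N\ge 0$ and $\hbar>0$. Write $z=(x,p)\in\mathbb R^{N}\times\mathbb R^{N}$ and $z\wedge z'=p\cdot x'-p'\cdot x$, and let $\mathbf H_N=\mathbb R^{2N}\times\mathbb R$ be the Heisenberg group with the law $(z,t)(z',t')=(z+z',\,t+t'+\tfrac12 z\wedge z')$. For $(z_0,t_0)\in\mathbf H_N$, $z_0=(x_0,p_0)$, define the unitary operators $$\widehat T_{\rm Sch}(z_0,t_0)\psi(x)=e^{\frac i\hbar(t_0+p_0\cdot x-\frac12p_0\cdot x_0)}\psi(x-x_0)\quad\text{on }L^2(\mathbb R^N),$$ $$\widehat T_{\rm ph}(z_0,t_0)\Psi(z)=e^{\frac i\hbar t_0}\,e^{-\frac{i}{2\hbar}z\wedge z_0}\,\Psi(z-z_0)\quad\text{on }L^2(\mathbb R^{2N}).$$ Both are representations of $\mathbf H_N$. Write $\widehat T(z_0)=\widehat T(z_0,0)$. For $\phi\in\mathcal S(\mathbb R^N)$ with $\|\phi\|_{L^2}=1$ let $$U_\phi\psi(z)=(2\pi\hbar)^{-N/2}e^{\frac{i}{2\hbar}p\cdot x}\int e^{-\frac i\hbar p\cdot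 x'}\psi(x')\,\phi(x-x')\,dx' .$$ For a symbol $A$ on $\mathbb R^{2N}$ let $\mathcal F_\sigma A(z)=(2\pi\hbar)^{-N}\int e^{-\frac i\hbar z\wedge z'}A(z')\,dz'$ (extended by duality to tempered distributions) and $$\widehat A_{\rm Sch}=(2\pi\hbar)^{-N}\!\int \mathcal F_\sigma A(z_0)\,\widehat T_{\rm Sch}(z_0)\,dz_0,\qquad \widehat A_{\rm ph}=(2\pi\hbar)^{-N}\!\int \mathcal F_\sigma A(z_0)\,\widehat T_{\rm ph}(z_0)\,dz_0 .$$ **Theorem.** For every such $\phi$ the transform $U_\phi$ is a linear isometry $L^2(\mathbb R^N)\to L^2(\mathbb R^{2N})$ with closed range $\mathcal H_\phi$, and: (i) $\widehat T_{\rm ph}(z_0,t_0)\,U_\phi=U_\phi\,\widehat T_{\rm Sch}(z_0,t_0)$ for all $(z_0,t_0)\in\mathbf H_N$. The space $\mathcal H_\phi$ is invariant under $\widehat T_{\rm ph}$, and the restriction of $\widehat T_{\rm ph}$ to $\mathcal H_\phi$ is unitarily equivalent to $\widehat T_{\rm Sch}$ and is an irreducible (strongly continuous) unitary representation of $\mathbf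 H_N$. (ii) $\widehat A_{\rm ph}U_\phi=U_\phi\widehat A_{\rm Sch}$, in each of the following senses. (a) For every tempered distribution $A\in\mathcal S'(\mathbb R^{2N})$ and every $\psi\in\mathcal S(\mathbb R^N)$ one has $\widehat A_{\rm ph}(U_\phi\psi)(z)=U_\phi(\widehat A_{\rm Sch}\psi)(z)$ for every $z\in\mathbb R^{2N}$. Here $U_\phi\psi\in\mathcal S(\mathbb R^{2N})$; for $\Psi\in\mathcal S(\mathbb R^{2N})$ the number $\widehat A_{\rm ph}\Psi(z)$ is $(2\pi\hbar)^{-N}$ times the value of $\mathcal F_\sigma A$ on the Schwartz function $z_0\mapsto(\widehat T_{\rm ph}(z_0)\Psi)(z)$; $\widehat A_{\rm Sch}\psi\in\mathcal S'(\mathbb R^N)$ is given by $\langle\widehat A_{\rm Sch}\psi,\chi\rangle=(2\pi\hbar)^{-N}\langle\mathcal F_\sigma A,\ z_0\mapsto\int(\widehat T_{\rm Sch}(z_0)\psi)\chi\,dx\rangle$; and $U_\phi$ acts on $\mathcal S'(\mathbb R^N)$ by evaluating the distribution on the integral kernel of $U_\phi$. (b) If, for some $A\in\mathcal S'(\mathbb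 R^{2N})$, the operators of (a) extend from Schwartz functions to bounded operators on $L^2(\mathbb R^N)$ and on $L^2(\mathbb R^{2N})$, then the extensions satisfy $\widehat A_{\rm ph}U_\phi=U_\phi\widehat A_{\rm Sch}$ on $L^2(\mathbb R^N)$. (c) If $A$ and $\mathcal F_\sigma A$ are integrable functions, then $\widehat A_{\rm ph}U_\phi\psi=U_\phi\widehat A_{\rm Sch}\psi$ for all $\psi\in L^2(\mathbb R^N)$, the integrals defining both operators applied to a vector being Bochner integrals in $L^2$. -/

import Mathlib

open MeasureTheory MeasureTheory.Measure SchwartzMap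
open scoped FourierTransform ContDiff

set_option linter.unusedSectionVars false

namespace PhaseSpaceWeyl

noncomputable section

/-! ### Auxiliary facts on Schwartz functions -/

section SchwartzTools

theorem hasTemperateGrowth_cexp_mul_I :
    Function.HasTemperateGrowth (fun t : ℝ => Complex.exp (t * Complex.I)) := by
  have hd : ∀ n : ℕ, iteratedDeriv n (fun t : ℝ => Complex.exp (t * Complex.I))
      = fun t : ℝ => Complex.I ^ n * Complex.exp (t * Complex.I) := by
    intro n
    induction n with
    | zero => simp
    | succ n ih =>
      rw [iteratedDeriv_succ, ih]
      ext t
      have h := ((Complex.ofRealCLM.hasDerivAt (x := t)).mul_const Complex.I).cexp.const_mul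
        (Complex.I ^ n)
      simp only [Complex.ofRealCLM_apply, Complex.ofReal_one, one_mul] at h
      rw [h.deriv]
      ring
  refine ⟨?_, fun n => ⟨0, 1, fun t => ?_⟩⟩
  · have h : ContDiff ℝ ∞ (fun t : ℝ => (t : ℂ)) := Complex.ofRealCLM.contDiff
    exact (h.mul contDiff_const).cexp
  · rw [norm_iteratedFDeriv_eq_norm_iteratedDeriv, hd n]
    simp [Complex.norm_exp_ofReal_mul_I]

variable {D : Type} [NormedAddCommGroup D] [NormedSpace ℝ D]

/-- For a Schwartz function `f`, the function `w ↦ e^{i (c + ℓ w)} f (a - w)` is Schwartz. -/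
theorem exists_schwartz_modulated_reflection (k : ℂ) (c : ℝ) (l : D →L[ℝ] ℝ) (a : D)
    (f : 𝓢(D, ℂ)) :
    ∃ g : 𝓢(D, ℂ), ∀ w, g w = k * Complex.exp (((c + l w : ℝ) : ℂ) * Complex.I) * f (a - w) := by
  have hl : Function.HasTemperateGrowth
      (fun w : D => k * Complex.exp (((c + l w : ℝ) : ℂ) * Complex.I)) :=
    (Function.HasTemperateGrowth.const k).mul (hasTemperateGrowth_cexp_mul_I.comp
      (f := fun w : D => c + l w)
      ((Function.HasTemperateGrowth.const c).add l.hasTemperateGrowth))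
  refine ⟨smulLeftCLM ℂ (fun w : D => k * Complex.exp (((c + l w : ℝ) : ℂ) * Complex.I))
    (compSubConstCLM ℂ a (compCLMOfContinuousLinearEquiv ℂ (ContinuousLinearEquiv.neg ℝ) f)), ?_⟩
  intro w
  rw [smulLeftCLM_apply_apply hl]
  simp

/-- The tensor product `(x, y) ↦ f x * g y` with a fixed Schwartz function `f`, as a continuous
linear map in the Schwartz function `g`. -/
theorem exists_tensor {E : Type} [NormedAddCommGroup E] [NormedSpace ℝ E]
    (f : 𝓢(D, ℂ)) :
    ∃ L : 𝓢(E, ℂ) →L[ℂ] 𝓢(D × E, ℂ), ∀ g z, L g z = f z.1 * g z.2 := by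
  refine ⟨mkCLM (fun g z => f z.1 * g z.2) (fun g h z => by simp [mul_add])
    (fun a g z => by simp [mul_left_comm])
    (fun g => ((f.smooth ⊤).comp contDiff_fst).mul ((g.smooth ⊤).comp contDiff_snd)) ?_,
    fun g z => rfl⟩
  rintro ⟨k, n⟩
  dsimp only
  have key : ∀ i ≤ n, ∃ C : ℝ, 0 ≤ C ∧ ∀ (g : 𝓢(E, ℂ)) (z : D × E),
      ‖z‖ ^ k * (‖iteratedFDeriv ℝ i (fun z : D × E => f z.1) z‖ *
        ‖iteratedFDeriv ℝ (n - i) (fun z : D × E => g z.2) z‖) ≤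
      C * ((Finset.Iic (k, n)).sup (schwartzSeminormFamily ℂ E ℂ)) g := by
    intro i hi
    refine ⟨SchwartzMap.seminorm ℝ k i f + SchwartzMap.seminorm ℝ 0 i f, by positivity,
      fun g z => ?_⟩
    have h1 : ‖iteratedFDeriv ℝ i (fun z : D × E => f z.1) z‖ ≤ ‖iteratedFDeriv ℝ i f z.1‖ := by
      have := (ContinuousLinearMap.fst ℝ D E).iteratedFDeriv_comp_right (f.smooth ⊤) z
        (i := i) (mod_cast le_top)
      change ‖iteratedFDeriv ℝ i (f ∘ (ContinuousLinearMap.fst ℝ D E)) z‖ ≤ _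
      rw [this]
      refine (ContinuousMultilinearMap.norm_compContinuousLinearMap_le _ _).trans ?_
      refine mul_le_of_le_one_right (norm_nonneg _) ?_
      exact Finset.prod_le_one (fun _ _ => norm_nonneg _)
        (fun _ _ => ContinuousLinearMap.norm_fst_le ℝ D E)
    have h2 : ‖iteratedFDeriv ℝ (n - i) (fun z : D × E => g z.2) z‖ ≤
        ‖iteratedFDeriv ℝ (n - i) g z.2‖ := by
      have := (ContinuousLinearMap.snd ℝ D E).iteratedFDeriv_comp_right (g.smooth ⊤) z
        (i := n - i) (by generalize n - i = j; exact_mod_cast le_top)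
      change ‖iteratedFDeriv ℝ (n - i) (g ∘ (ContinuousLinearMap.snd ℝ D E)) z‖ ≤ _
      rw [this]
      refine (ContinuousMultilinearMap.norm_compContinuousLinearMap_le _ _).trans ?_
      refine mul_le_of_le_one_right (norm_nonneg _) ?_
      exact Finset.prod_le_one (fun _ _ => norm_nonneg _)
        (fun _ _ => ContinuousLinearMap.norm_snd_le ℝ D E)
    have hz : ‖z‖ ^ k ≤ ‖z.1‖ ^ k + ‖z.2‖ ^ k := by
      rcases le_total ‖z.1‖ ‖z.2‖ with h | h
      · rw [Prod.norm_def, max_eq_right h]; exact le_add_of_nonneg_left (by positivity)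
      · rw [Prod.norm_def, max_eq_left h]; exact le_add_of_nonneg_right (by positivity)
    set S := ((Finset.Iic (k, n)).sup (schwartzSeminormFamily ℂ E ℂ)) g with hS
    have hg : ∀ k' ≤ k, ‖z.2‖ ^ k' * ‖iteratedFDeriv ℝ (n - i) g z.2‖ ≤ S := by
      intro k' hk'
      refine (SchwartzMap.le_seminorm ℂ k' (n - i) g z.2).trans ?_
      exact Seminorm.le_def.1 (Finset.le_sup (f := schwartzSeminormFamily ℂ E ℂ)
        (Finset.mem_Iic.2 (show ((k', n - i) : ℕ × ℕ) ≤ (k, n) from ⟨hk', Nat.sub_le _ _⟩))) g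
    have hg0 := hg 0 (Nat.zero_le _)
    have hgk := hg k le_rfl
    rw [pow_zero, one_mul] at hg0
    have hf0 := SchwartzMap.le_seminorm ℝ 0 i f z.1
    have hfk := SchwartzMap.le_seminorm ℝ k i f z.1
    rw [pow_zero, one_mul] at hf0
    calc _ ≤ (‖z.1‖ ^ k + ‖z.2‖ ^ k) * (‖iteratedFDeriv ℝ i f z.1‖ *
            ‖iteratedFDeriv ℝ (n - i) g z.2‖) := by gcongr
      _ = (‖z.1‖ ^ k * ‖iteratedFDeriv ℝ i f z.1‖) * ‖iteratedFDeriv ℝ (n - i) g z.2‖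
          + ‖iteratedFDeriv ℝ i f z.1‖ * (‖z.2‖ ^ k * ‖iteratedFDeriv ℝ (n - i) g z.2‖) := by ring
      _ ≤ SchwartzMap.seminorm ℝ k i f * S + SchwartzMap.seminorm ℝ 0 i f * S := by gcongr
      _ = _ := by ring
  choose! C hC0 hC using key
  refine ⟨Finset.Iic (k, n), ∑ i ∈ Finset.range (n + 1), (n.choose i) * C i,
    Finset.sum_nonneg fun i hi => mul_nonneg (by positivity)
      (hC0 i (Nat.lt_succ_iff.1 (Finset.mem_range.1 hi))), fun g z => ?_⟩
  have hm := norm_iteratedFDeriv_mul_le (𝕜 := ℝ) (N := ∞)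
    ((f.smooth ⊤).comp (contDiff_fst (E := D) (F := E)))
    ((g.smooth ⊤).comp (contDiff_snd (E := D) (F := E))) z (n := n) (mod_cast le_top)
  calc _ ≤ ‖z‖ ^ k * ∑ i ∈ Finset.range (n + 1), (n.choose i : ℝ) *
          ‖iteratedFDeriv ℝ i (fun z : D × E => f z.1) z‖ *
          ‖iteratedFDeriv ℝ (n - i) (fun z : D × E => g z.2) z‖ := by gcongr; exact hm
    _ = ∑ i ∈ Finset.range (n + 1), (n.choose i : ℝ) * (‖z‖ ^ k *
          (‖iteratedFDeriv ℝ i (fun z : D × E => f z.1) z‖ *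
          ‖iteratedFDeriv ℝ (n - i) (fun z : D × E => g z.2) z‖)) := by
        rw [Finset.mul_sum]; refine Finset.sum_congr rfl fun i _ => ?_; ring
    _ ≤ ∑ i ∈ Finset.range (n + 1), (n.choose i : ℝ) *
          (C i * ((Finset.Iic (k, n)).sup (schwartzSeminormFamily ℂ E ℂ)) g) := by
        refine Finset.sum_le_sum fun i hi => ?_
        refine mul_le_mul_of_nonneg_left ?_ (by positivity)
        exact hC i (Nat.lt_succ_iff.1 (Finset.mem_range.1 hi)) g z
    _ = _ := by rw [Finset.sum_mul]; refine Finset.sum_congr rfl fun i _ => ?_; ring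

variable {E : Type} [NormedAddCommGroup E] [InnerProductSpace ℝ E] [FiniteDimensional ℝ E]
  [MeasurableSpace E] [BorelSpace E]
  {V : Type} [NormedAddCommGroup V] [NormedSpace ℝ V] [NormedSpace ℂ V] [IsScalarTower ℝ ℂ V]

/-- The integrand `e^{-i c p·y} F (x, y)` of the partial Fourier transform. -/
def partialFourierIntegrand (c : ℝ) (F : E × E → V) (z : E × E) (y : E) : V :=
  Complex.exp (((-(c * inner ℝ z.2 y) : ℝ) : ℂ) * Complex.I) • F (z.1, y)

theorem norm_partialFourierIntegrand (c : ℝ) (F : E × E → V) (z : E × E) (y : E) :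
    ‖partialFourierIntegrand c F z y‖ = ‖F (z.1, y)‖ := by
  rw [partialFourierIntegrand, norm_smul, Complex.norm_exp_ofReal_mul_I, one_mul]

/-- The partial Fourier transform `(x, p) ↦ ∫ e^{-i c p·y} F (x, y) dy`. -/
def partialFourier (c : ℝ) (F : E × E → V) (z : E × E) : V :=
  ∫ y, partialFourierIntegrand c F z y

theorem normedSpace_eq_complexToReal (V : Type) [NormedAddCommGroup V] [i : NormedSpace ℝ V]
    [NormedSpace ℂ V] [IsScalarTower ℝ ℂ V] : i = NormedSpace.complexToReal := by
  have h : i.toModule = (NormedSpace.complexToReal (E := V)).toModule :=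
    Module.ext' _ _ fun r v => by
      change r • v = (r : ℂ) • v
      rw [← Complex.coe_algebraMap, algebraMap_smul]
  cases i
  simp only at h
  subst h
  rfl

theorem partialFourier_eq (c : ℝ) (F : E × E → V) (z : E × E) :
    partialFourier c F z = 𝓕 (fun y => F (z.1, y)) ((c / (2 * Real.pi)) • z.2) := by
  obtain rfl := normedSpace_eq_complexToReal V
  rw [Real.fourier_eq']
  refine integral_congr_ae (Filter.Eventually.of_forall fun y => ?_)
  simp only [partialFourierIntegrand]
  congr 3
  rw [inner_smul_right, real_inner_comm]
  have := Real.pi_ne_zero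
  field_simp

theorem schwartz_slice_bound (k : ℕ) :
    ∃ q : Seminorm ℂ 𝓢(E × E, V), Continuous q ∧ ∀ (F : 𝓢(E × E, V)) (x y : E),
      ‖x‖ ^ k * ‖F (x, y)‖ ≤
        2 ^ (k + (volume : Measure E).integrablePower) * q F * (1 + ‖y‖) ^ (-((volume : Measure E).integrablePower : ℝ)) := by
  set r := (volume : Measure E).integrablePower
  refine ⟨(Finset.Iic (k + r, 0)).sup (schwartzSeminormFamily ℂ (E × E) V), ?_, ?_⟩
  · exact Seminorm.continuous_finsetSup fun i _ =>
      (schwartz_withSeminorms ℂ (E × E) V).continuous_seminorm i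
  · intro F x y
    have h := one_add_le_sup_seminorm_apply (𝕜 := ℂ) (m := (k + r, 0)) (k := k + r) (n := 0)
      le_rfl le_rfl F (x, y)
    rw [norm_iteratedFDeriv_zero] at h
    rw [Real.rpow_neg (by positivity), ← div_eq_mul_inv, le_div_iff₀ (by positivity),
      Real.rpow_natCast]
    calc _ = (‖x‖ ^ k * (1 + ‖y‖) ^ r) * ‖F (x, y)‖ := by ring
      _ ≤ ((1 + ‖(x, y)‖) ^ k * (1 + ‖(x, y)‖) ^ r) * ‖F (x, y)‖ := by
        have h1 : ‖x‖ ≤ 1 + ‖(x, y)‖ := (norm_fst_le (x, y)).trans (by simp)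
        have h2 : ‖y‖ ≤ ‖(x, y)‖ := norm_snd_le (x, y)
        gcongr
      _ ≤ _ := by rw [← pow_add]; exact h

theorem integrable_slice (F : 𝓢(E × E, V)) (x : E) : Integrable (fun y => F (x, y)) := by
  obtain ⟨q, -, hq⟩ := schwartz_slice_bound (E := E) (V := V) 0
  refine Integrable.mono' ((integrable_pow_neg_integrablePower
    (volume : Measure E)).const_mul
      (2 ^ (0 + (volume : Measure E).integrablePower) * q F)) ?_ (Filter.Eventually.of_forall fun y => ?_)
  · exact (F.continuous.comp (by fun_prop : Continuous fun y : E => (x, y))).aestronglyMeasurable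
  · simpa using hq F x y

theorem aestronglyMeasurable_slice (c : ℝ) (F : 𝓢(E × E, V)) (z : E × E) :
    AEStronglyMeasurable (partialFourierIntegrand c F z) := by
  have h : Continuous (fun y : E =>
      Complex.exp (((-(c * inner ℝ z.2 y) : ℝ) : ℂ) * Complex.I)) := by fun_prop
  exact (h.smul (F.continuous.comp
      (by fun_prop : Continuous fun y : E => (z.1, y)))).aestronglyMeasurable

theorem partialFourier_bound_fst (c : ℝ) (k : ℕ) :
    ∃ (q : Seminorm ℂ 𝓢(E × E, V)) (C : ℝ), Continuous q ∧ 0 ≤ C ∧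
      ∀ (F : 𝓢(E × E, V)) (z : E × E),
      ‖z.1‖ ^ k * ‖partialFourier c F z‖ ≤ C * q F := by
  obtain ⟨q, hqc, hq⟩ := schwartz_slice_bound (E := E) (V := V) k
  set J := ∫ y : E, (1 + ‖y‖) ^ (-((volume : Measure E).integrablePower : ℝ))
  have hJ : 0 ≤ J := integral_nonneg fun y => by positivity
  set K : ℝ := 2 ^ (k + (volume : Measure E).integrablePower)
  refine ⟨q, K * J, hqc, by positivity, fun F z => ?_⟩
  have hint := integrable_pow_neg_integrablePower (volume : Measure E)
  calc _ ≤ ‖z.1‖ ^ k * ∫ y, ‖F (z.1, y)‖ := by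
        gcongr
        refine (norm_integral_le_integral_norm _).trans_eq ?_
        simp only [norm_partialFourierIntegrand]
    _ = ∫ y, ‖z.1‖ ^ k * ‖F (z.1, y)‖ := (integral_const_mul _ _).symm
    _ ≤ ∫ y, K * q F * (1 + ‖y‖) ^ (-((volume : Measure E).integrablePower : ℝ)) :=
        integral_mono ((integrable_slice F z.1).norm.const_mul _) (hint.const_mul _)
          fun y => hq F z.1 y
    _ = K * J * q F := by rw [integral_const_mul]; ring

theorem partialFourier_bound_snd {c : ℝ} (hc : c ≠ 0) (k : ℕ) :
    ∀ (V : Type) [NormedAddCommGroup V] [NormedSpace ℝ V] [NormedSpace ℂ V] [IsScalarTower ℝ ℂ V],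
    ∃ (q : Seminorm ℂ 𝓢(E × E, V)) (C : ℝ), Continuous q ∧ 0 ≤ C ∧
      ∀ (F : 𝓢(E × E, V)) (z : E × E),
      ‖z.2‖ ^ k * ‖partialFourier c F z‖ ≤ C * q F := by
  induction k with
  | zero =>
    intro V _ iR _ _
    obtain ⟨q, C, hqc, hC, hq⟩ := partialFourier_bound_fst (E := E) (V := V) c 0
    exact ⟨q, C, hqc, hC, fun F z => by simpa using hq F z⟩
  | succ k ih =>
    intro V _ iR _ _
    obtain rfl := normedSpace_eq_complexToReal V
    obtain ⟨q, C, hqc, hC, hq⟩ := ih (E →L[ℝ] V)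
    let P : (E × E →L[ℝ] V) →L[ℂ] (E →L[ℝ] V) :=
      { toFun := fun T => T.comp (ContinuousLinearMap.inr ℝ E E)
        map_add' := fun _ _ => by ext; simp
        map_smul' := fun _ _ => by ext; simp
        cont := by fun_prop }
    let L : 𝓢(E × E, V) →L[ℂ] 𝓢(E × E, E →L[ℝ] V) :=
      (postcompCLM P).comp (fderivCLM ℂ (E × E) V)
    refine ⟨q.comp L.toLinearMap, |c|⁻¹ * C, hqc.comp L.continuous, by positivity,
      fun F z => ?_⟩
    have hder : ∀ y, HasFDerivAt (fun y => F (z.1, y)) (L F (z.1, y)) y := fun y =>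
      (F.differentiable (z.1, y)).hasFDerivAt.comp y (hasFDerivAt_prodMk_right z.1 y)
    have hfd : fderiv ℝ (fun y => F (z.1, y)) = fun y => L F (z.1, y) :=
      funext fun y => (hder y).fderiv
    have h := Real.fourier_fderiv (integrable_slice F z.1) (fun y => (hder y).differentiableAt)
      (by rw [hfd]; exact integrable_slice (L F) z.1)
    rw [hfd] at h
    have h' := congrFun h ((c / (2 * Real.pi)) • z.2)
    rw [← partialFourier_eq c (L F) z] at h'
    have hn : ‖partialFourier c (L F) z‖ = |c| * (‖z.2‖ * ‖partialFourier c F z‖) := by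
      rw [h', partialFourier_eq c F z]
      rw [VectorFourier.norm_fourierSMulRight, _root_.neg_apply, norm_neg,
        innerSL_apply_norm, norm_smul, Real.norm_eq_abs, abs_div,
        abs_of_pos (by positivity : 0 < 2 * Real.pi)]
      field_simp
    have hc' : 0 < |c| := abs_pos.2 hc
    have := hq (L F) z
    rw [hn] at this
    change _ ≤ |c|⁻¹ * C * q (L F)
    rw [mul_assoc, inv_mul_eq_div, le_div_iff₀ hc', pow_succ]
    calc _ = _ := by ring
      _ ≤ _ := this

theorem partialFourier_bound {c : ℝ} (hc : c ≠ 0) (k : ℕ) :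
    ∃ (q : Seminorm ℂ 𝓢(E × E, V)) (C : ℝ), Continuous q ∧ 0 ≤ C ∧
      ∀ (F : 𝓢(E × E, V)) (z : E × E),
      ‖z‖ ^ k * ‖partialFourier c F z‖ ≤ C * q F := by
  obtain ⟨q₁, C₁, hc₁, hC₁, h₁⟩ := partialFourier_bound_fst (E := E) (V := V) c k
  obtain ⟨q₂, C₂, hc₂, hC₂, h₂⟩ := partialFourier_bound_snd (E := E) hc k V
  refine ⟨q₁ + q₂, C₁ + C₂, hc₁.add hc₂, by positivity, fun F z => ?_⟩
  have h₁ := h₁ F z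
  have h₂ := h₂ F z
  have p₁ : 0 ≤ q₁ F := apply_nonneg _ _
  have p₂ : 0 ≤ q₂ F := apply_nonneg _ _
  change _ ≤ (C₁ + C₂) * (q₁ F + q₂ F)
  have m₁ := mul_nonneg hC₁ p₁
  have m₂ := mul_nonneg hC₁ p₂
  have m₃ := mul_nonneg hC₂ p₁
  have m₄ := mul_nonneg hC₂ p₂
  rcases le_total ‖z.1‖ ‖z.2‖ with h | h
  · rw [Prod.norm_def, max_eq_right h]; nlinarith
  · rw [Prod.norm_def, max_eq_left h]; nlinarith

/-- Differentiating `partialFourier c F` amounts to replacing `F` by another Schwartz function. -/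
theorem exists_fderiv_partialFourier (c : ℝ) :
    ∃ L : 𝓢(E × E, V) →L[ℂ] 𝓢(E × E, E × E →L[ℝ] V), ∀ (F : 𝓢(E × E, V)) (z : E × E),
      HasFDerivAt (partialFourier c F) (partialFourier c (L F) z) z := by
  let B : E × E →L[ℝ] (E × E →L[ℝ] ℝ) :=
    ((ContinuousLinearMap.compL ℝ (E × E) E ℝ).flip (ContinuousLinearMap.snd ℝ E E)).comp
      ((innerSL ℝ).comp (ContinuousLinearMap.snd ℝ E E))
  have hB : ∀ w w', B w w' = inner ℝ w.2 w'.2 := fun w w' => by simp [B]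
  obtain ⟨L, hL⟩ : ∃ L : 𝓢(E × E, V) →L[ℂ] 𝓢(E × E, E × E →L[ℝ] V), ∀ F w w', L F w w' =
      fderiv ℝ F w (w'.1, 0) + (-(c : ℂ) * Complex.I) • inner ℝ w.2 w'.2 • F w := by
    let P : (E × E →L[ℝ] V) →L[ℂ] (E × E →L[ℝ] V) :=
      { toFun := fun T => T.comp ((ContinuousLinearMap.inl ℝ E E).comp
          (ContinuousLinearMap.fst ℝ E E))
        map_add' := fun _ _ => by ext <;> simp
        map_smul' := fun _ _ => by ext <;> simp
        cont := by fun_prop }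
    refine ⟨(postcompCLM P).comp (fderivCLM ℂ (E × E) V) +
      (-(c : ℂ) * Complex.I) • smulRightCLM ℂ V B, fun F w w' => ?_⟩
    simp [P, B]
  refine ⟨L, fun F z => ?_⟩
  obtain ⟨q, -, hq⟩ := schwartz_slice_bound (E := E) (V := E × E →L[ℝ] V) 0
  refine hasFDerivAt_integral_of_dominated_of_fderiv_le (𝕜 := ℝ)
    (F := partialFourierIntegrand c F) (F' := partialFourierIntegrand c (L F))
    (bound := fun y => 2 ^ (0 + (volume : Measure E).integrablePower) * q (L F) * (1 + ‖y‖) ^ (-((volume : Measure E).integrablePower : ℝ)))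
    (s := Set.univ) Filter.univ_mem ?_ ?_ ?_ ?_ ?_ ?_
  · exact Filter.Eventually.of_forall fun z => aestronglyMeasurable_slice c F z
  · refine (integrable_slice F z.1).mono (aestronglyMeasurable_slice c F z)
      (Filter.Eventually.of_forall fun y => ?_)
    rw [norm_partialFourierIntegrand]
  · exact aestronglyMeasurable_slice c (L F) z
  · refine Filter.Eventually.of_forall fun y z _ => ?_
    rw [norm_partialFourierIntegrand]
    simpa using hq (L F) z.1 y
  · exact (integrable_pow_neg_integrablePower (volume : Measure E)).const_mul _
  · refine Filter.Eventually.of_forall fun y z _ => ?_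
    have h1 : HasFDerivAt (fun z : E × E => F (z.1, y))
        ((fderiv ℝ F (z.1, y)).comp ((ContinuousLinearMap.inl ℝ E E).comp
          (ContinuousLinearMap.fst ℝ E E))) z := by
      have ha : HasFDerivAt (fun z : E × E => (z.1, y))
          ((ContinuousLinearMap.inl ℝ E E).comp (ContinuousLinearMap.fst ℝ E E)) z :=
        HasFDerivAt.comp (g := fun x : E => (x, y)) z (hasFDerivAt_prodMk_left z.1 y)
          hasFDerivAt_fst
      exact (F.differentiable (z.1, y)).hasFDerivAt.comp z ha
    have h2 : HasFDerivAt (fun z : E × E => -(c * inner ℝ z.2 y)) (-(c • B (z.1, y))) z := by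
      have h : HasFDerivAt (fun z : E × E => inner ℝ z.2 y) (B (z.1, y)) z := by
        have : (fun z : E × E => inner ℝ z.2 y) = B (z.1, y) := by
          ext w; simp [hB, real_inner_comm]
        rw [this]
        exact (B (z.1, y)).hasFDerivAt
      exact (h.const_mul c).neg
    have h3 := ((Complex.ofRealCLM.hasFDerivAt.comp z h2).mul_const Complex.I).cexp
    have h4 := h3.smul h1
    rw [partialFourierIntegrand]
    refine h4.congr_fderiv ?_
    ext w
    · simp [hL, hB]
    · simp only [ContinuousLinearMap.comp_apply, ContinuousLinearMap.inr_apply]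
      simp [hL, hB]
      rw [← algebraMap_smul ℂ (inner ℝ y w) (F (z.1, y)), smul_smul, smul_smul]
      congr 1
      simp only [Complex.coe_algebraMap]
      ring

theorem partialFourier_smooth_bound {c : ℝ} (hc : c ≠ 0) (n : ℕ) :
    ∀ (V : Type) [NormedAddCommGroup V] [NormedSpace ℝ V] [NormedSpace ℂ V] [IsScalarTower ℝ ℂ V]
      (k : ℕ),
    (∀ F : 𝓢(E × E, V), ContDiff ℝ n (partialFourier c F)) ∧
    ∃ (q : Seminorm ℂ 𝓢(E × E, V)) (C : ℝ), Continuous q ∧ 0 ≤ C ∧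
      ∀ (F : 𝓢(E × E, V)) (z : E × E),
      ‖z‖ ^ k * ‖iteratedFDeriv ℝ n (partialFourier c F) z‖ ≤ C * q F := by
  induction n with
  | zero =>
    intro V _ _ _ _ k
    obtain ⟨L, hL⟩ := exists_fderiv_partialFourier (E := E) (V := V) c
    refine ⟨fun F => ?_, ?_⟩
    · rw [Nat.cast_zero, contDiff_zero]
      exact continuous_iff_continuousAt.2 fun z => (hL F z).continuousAt
    · simpa only [norm_iteratedFDeriv_zero] using partialFourier_bound (E := E) (V := V) hc k
  | succ n ih =>
    intro V _ _ _ _ k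
    obtain ⟨L, hL⟩ := exists_fderiv_partialFourier (E := E) (V := V) c
    obtain ⟨hsm, q, C, hqc, hC, hq⟩ := ih (E × E →L[ℝ] V) k
    have hfd : ∀ F : 𝓢(E × E, V), fderiv ℝ (partialFourier c F) = partialFourier c (L F) :=
      fun F => funext fun z => (hL F z).fderiv
    refine ⟨fun F => ?_, q.comp L.toLinearMap, C, ?_, hC, fun F z => ?_⟩
    · rw [Nat.cast_succ, contDiff_succ_iff_fderiv]
      refine ⟨fun z => (hL F z).differentiableAt, by simp, ?_⟩
      rw [hfd]
      exact hsm (L F)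
    · exact (show Continuous fun F => q (L F) from hqc.comp L.continuous)
    · rw [← norm_iteratedFDeriv_fderiv, hfd]
      exact hq (L F) z

/-- The partial Fourier transform is a continuous linear operator on the Schwartz space. -/
theorem exists_partialFourierCLM {c : ℝ} (hc : c ≠ 0) :
    ∃ L : 𝓢(E × E, ℂ) →L[ℂ] 𝓢(E × E, ℂ), ∀ F z, L F z = ∫ y,
      Complex.exp (((-(c * inner ℝ z.2 y) : ℝ) : ℂ) * Complex.I) * F (z.1, y) := by
  refine ⟨mkCLM (fun F => partialFourier c F) (fun F G z => ?_) (fun a F z => ?_) (fun F => ?_) ?_,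
    fun F z => rfl⟩
  · have h : ∀ F : 𝓢(E × E, ℂ), Integrable (partialFourierIntegrand c F z) := fun F =>
      (integrable_slice F z.1).mono (aestronglyMeasurable_slice c F z)
        (Filter.Eventually.of_forall fun y => by rw [norm_partialFourierIntegrand])
    simp only [partialFourier]
    rw [← integral_add (h F) (h G)]
    simp [partialFourierIntegrand, mul_add]
  · simp only [partialFourier]
    rw [RingHom.id_apply, ← integral_smul]
    simp [partialFourierIntegrand, mul_left_comm]
  · exact contDiff_infty.2 fun n =>
      (partialFourier_smooth_bound (E := E) hc n ℂ 0).1 F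
  · rintro ⟨k, n⟩
    obtain ⟨-, q, C, hqc, hC, hq⟩ := partialFourier_smooth_bound (E := E) hc n ℂ k
    obtain ⟨s, C', -, hs⟩ := Seminorm.bound_of_continuous (schwartz_withSeminorms ℂ (E × E) ℂ) q hqc
    refine ⟨s, C * C', by positivity, fun F z => (hq F z).trans ?_⟩
    rw [mul_assoc]
    exact mul_le_mul_of_nonneg_left (hs F) hC

end SchwartzTools

/-! ### Phase space and the Heisenberg group -/

/-- Configuration space `ℝᴺ` with the Euclidean structure. -/
abbrev Conf (N : ℕ) : Type := EuclideanSpace ℝ (Fin N)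

/-- Phase space `ℝ²ᴺ`; a point is `z = (x, p)` with `x = z.1` and `p = z.2`. -/
abbrev Phase (N : ℕ) : Type := Conf N × Conf N

instance (N : ℕ) : (volume : Measure (Phase N)).IsAddHaarMeasure :=
  inferInstanceAs ((volume : Measure (Conf N)).prod (volume : Measure (Conf N))).IsAddHaarMeasure

/-- The Hilbert space `L²(X)` of complex-valued functions. -/
abbrev L2 (X : Type) [MeasureSpace X] : Type := Lp ℂ 2 (volume : Measure X)

variable {N : ℕ}

/-- The symplectic product `z ∧ z' = p·x' - p'·x`. -/
def wedge (z z' : Phase N) : ℝ := inner ℝ z.2 z'.1 - inner ℝ z'.2 z.1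

/-- The Heisenberg group: pairs `(z, t)` with
`(z, t) (z', t') = (z + z', t + t' + ½ z ∧ z')`. -/
@[ext] structure Heisenberg (N : ℕ) where
  z : Phase N
  t : ℝ

namespace Heisenberg

instance : Mul (Heisenberg N) := ⟨fun g h => ⟨g.z + h.z, g.t + h.t + 1 / 2 * wedge g.z h.z⟩⟩
instance : One (Heisenberg N) := ⟨⟨0, 0⟩⟩
instance : Inv (Heisenberg N) := ⟨fun g => ⟨-g.z, -g.t⟩⟩

@[simp] theorem mul_z (g h : Heisenberg N) : (g * h).z = g.z + h.z := rfl
@[simp] theorem mul_t (g h : Heisenberg N) :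
    (g * h).t = g.t + h.t + 1 / 2 * wedge g.z h.z := rfl
@[simp] theorem one_z : (1 : Heisenberg N).z = 0 := rfl
@[simp] theorem one_t : (1 : Heisenberg N).t = 0 := rfl
@[simp] theorem inv_z (g : Heisenberg N) : g⁻¹.z = -g.z := rfl
@[simp] theorem inv_t (g : Heisenberg N) : g⁻¹.t = -g.t := rfl

instance : Group (Heisenberg N) :=
  Group.ofLeftAxioms
    (fun a b c => by
      ext1
      · simp [add_assoc]
      · simp only [mul_t, mul_z, wedge, Prod.fst_add, Prod.snd_add, inner_add_left,
          inner_add_right]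
        ring)
    (fun a => by
      ext1
      · simp
      · simp [wedge])
    (fun a => by
      ext1
      · simp
      · simp [wedge])

/-- The topology of `ℝ²ᴺ × ℝ`. -/
instance : TopologicalSpace (Heisenberg N) :=
  TopologicalSpace.induced (fun g => (g.z, g.t)) inferInstance

end Heisenberg

/-! ### Unitary representations -/

section Representations

variable {H H₁ H₂ : Type} [NormedAddCommGroup H] [InnerProductSpace ℂ H]
  [NormedAddCommGroup H₁] [InnerProductSpace ℂ H₁]
  [NormedAddCommGroup H₂] [InnerProductSpace ℂ H₂]

/-- A homomorphism of a group into the linear isometries of a Hilbert space takes values in the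
unitary operators. -/
def unitaryOfIsometric {G : Type} [Group G] (π : G →* (H →ₗᵢ[ℂ] H)) : G →* (H ≃ₗᵢ[ℂ] H) where
  toFun g :=
    { toLinearEquiv := LinearEquiv.ofLinearMap (π g).toLinearMap (π g⁻¹).toLinearMap
        (LinearMap.ext fun v => by
          change (π g * π g⁻¹) v = v
          rw [← map_mul, mul_inv_cancel, map_one]; rfl)
        (LinearMap.ext fun v => by
          change (π g⁻¹ * π g) v = v
          rw [← map_mul, inv_mul_cancel, map_one]; rfl)
      norm_map' := fun v => (π g).norm_map v }
  map_one' := by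
    ext v
    change π 1 v = v
    rw [map_one]; rfl
  map_mul' g h := by
    ext v
    change π (g * h) v = π g (π h v)
    rw [map_mul]; rfl

@[simp] theorem unitaryOfIsometric_apply {G : Type} [Group G] (π : G →* (H →ₗᵢ[ℂ] H)) (g : G)
    (v : H) : unitaryOfIsometric π g v = π g v := rfl

/-- A homomorphism `π` of the Heisenberg group into the unitary operators of `H` is an irreducible
unitary representation: it is strongly continuous, `H ≠ 0`, and no closed subspace other than `0`
and `H` is invariant under all operators `π g`. -/
structure IsIrreducibleUnitaryRep (π : Heisenberg N →* (H ≃ₗᵢ[ℂ] H)) : Prop where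
  strongly_continuous : ∀ v : H, Continuous fun g => π g v
  nontrivial : Nontrivial H
  irreducible : ∀ K : Submodule ℂ H, IsClosed (K : Set H) → (∀ g, ∀ v ∈ K, π g v ∈ K) →
    K = ⊥ ∨ K = ⊤

/-- Unitary equivalence: a unitary bijection intertwines the two representations. -/
def UnitarilyEquivalent (π₁ : Heisenberg N →* (H₁ ≃ₗᵢ[ℂ] H₁))
    (π₂ : Heisenberg N →* (H₂ ≃ₗᵢ[ℂ] H₂)) : Prop :=
  ∃ W : H₁ ≃ₗᵢ[ℂ] H₂, ∀ g v, W (π₁ g v) = π₂ g (W v)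

end Representations

/-! ### Modulated translations on `L²` -/

section ModulatedTranslation

variable {X : Type} [NormedAddCommGroup X] [MeasureSpace X] [BorelSpace X]
  [(volume : Measure X).IsAddRightInvariant]

theorem memLp_modTranslate {θ : X → ℝ} (hθ : Continuous θ) (a : X) (f : L2 X) :
    MemLp (fun x => Complex.exp ((θ x : ℂ) * Complex.I) * f (x - a)) 2 := by
  have h := (Lp.memLp f).comp_measurePreserving (measurePreserving_sub_right volume a)
  refine h.of_le (AEStronglyMeasurable.mul ?_ h.1) (Filter.Eventually.of_forall fun x => ?_)
  · exact Measurable.aestronglyMeasurable (by fun_prop)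
  · simp [Complex.norm_exp_ofReal_mul_I]

/-- The isometry `f ↦ e^{i θ(x)} f(x - a)` of `L²(X)`. -/
def modTranslate (θ : X → ℝ) (hθ : Continuous θ) (a : X) : L2 X →ₗᵢ[ℂ] L2 X where
  toFun f := (memLp_modTranslate hθ a f).toLp _
  map_add' f g := by
    rw [← MemLp.toLp_add]
    refine MemLp.toLp_congr _ _ ?_
    filter_upwards [(measurePreserving_sub_right volume a).quasiMeasurePreserving.ae
      (Lp.coeFn_add f g)] with x hx
    simp only [Pi.add_apply] at hx ⊢
    rw [hx, mul_add]
  map_smul' c f := by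
    rw [RingHom.id_apply, ← MemLp.toLp_const_smul]
    refine MemLp.toLp_congr _ _ ?_
    filter_upwards [(measurePreserving_sub_right volume a).quasiMeasurePreserving.ae
      (Lp.coeFn_smul c f)] with x hx
    simp only [Pi.smul_apply, smul_eq_mul] at hx ⊢
    rw [hx, mul_left_comm]
  norm_map' f := by
    change ‖(memLp_modTranslate hθ a f).toLp _‖ = _
    rw [Lp.norm_toLp, Lp.norm_def]
    congr 1
    rw [← eLpNorm_comp_measurePreserving (Lp.aestronglyMeasurable f)
      (measurePreserving_sub_right volume a)]
    refine eLpNorm_congr_norm_ae (Filter.Eventually.of_forall fun x => ?_)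
    simp [Complex.norm_exp_ofReal_mul_I]

theorem coeFn_modTranslate (θ : X → ℝ) (hθ : Continuous θ) (a : X) (f : L2 X) :
    modTranslate θ hθ a f =ᵐ[volume] fun x => Complex.exp ((θ x : ℂ) * Complex.I) * f (x - a) :=
  (memLp_modTranslate hθ a f).coeFn_toLp

theorem modTranslate_mul {θ₁ θ₂ θ : X → ℝ} (h₁ : Continuous θ₁) (h₂ : Continuous θ₂)
    (h : Continuous θ) {a₁ a₂ a : X} (ha : a = a₁ + a₂)
    (hθ : ∀ x, θ x = θ₁ x + θ₂ (x - a₁)) :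
    modTranslate θ h a = modTranslate θ₁ h₁ a₁ * modTranslate θ₂ h₂ a₂ := by
  ext1 f
  refine Lp.ext ?_
  change _ =ᵐ[volume] modTranslate θ₁ h₁ a₁ (modTranslate θ₂ h₂ a₂ f)
  filter_upwards [coeFn_modTranslate θ h a f,
    coeFn_modTranslate θ₁ h₁ a₁ (modTranslate θ₂ h₂ a₂ f),
    (measurePreserving_sub_right volume a₁).quasiMeasurePreserving.ae
      (coeFn_modTranslate θ₂ h₂ a₂ f)] with x hx hx₁ hx₂
  rw [hx, hx₁, hx₂, ← mul_assoc, ← Complex.exp_add, hθ, ha, sub_sub]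
  congr 2
  push_cast
  ring

theorem modTranslate_one {θ : X → ℝ} (h : Continuous θ) {a : X} (ha : a = 0)
    (hθ : ∀ x, θ x = 0) : modTranslate θ h a = 1 := by
  ext1 f
  refine Lp.ext ?_
  filter_upwards [coeFn_modTranslate θ h a f] with x hx
  rw [hx, hθ, ha]
  simp

end ModulatedTranslation

/-! ### The Schrödinger and the phase-space representation -/

/-- `(T_Sch(z₀, t₀) f)(x) = exp[(i/ħ)(t₀ + p₀·x - ½ p₀·x₀)] f(x - x₀)`. -/
def schAction (ħ : ℝ) (g : Heisenberg N) (f : Conf N → ℂ) (x : Conf N) : ℂ :=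
  Complex.exp (((1 / ħ * (g.t + inner ℝ g.z.2 x - 1 / 2 * inner ℝ g.z.2 g.z.1) : ℝ) : ℂ)
    * Complex.I) * f (x - g.z.1)

/-- `(T_ph(z₀, t₀) F)(z) = exp[(i/ħ)(t₀ - ½ z ∧ z₀)] F(z - z₀)`. -/
def phAction (ħ : ℝ) (g : Heisenberg N) (F : Phase N → ℂ) (z : Phase N) : ℂ :=
  Complex.exp (((1 / ħ * (g.t - 1 / 2 * wedge z g.z) : ℝ) : ℂ) * Complex.I) * F (z - g.z)

/-- The Schrödinger representation of the Heisenberg group on `L²(ℝᴺ)`: the unitary operators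
`ψ ↦ schAction ħ g ψ`. -/
def tSch (ħ : ℝ) : Heisenberg N →* (L2 (Conf N) ≃ₗᵢ[ℂ] L2 (Conf N)) :=
  unitaryOfIsometric
    { toFun := fun g => modTranslate
        (fun x => 1 / ħ * (g.t + inner ℝ g.z.2 x - 1 / 2 * inner ℝ g.z.2 g.z.1))
        (by fun_prop) g.z.1
      map_one' := modTranslate_one _ (by simp) (by simp)
      map_mul' := fun g h => modTranslate_mul _ _ _ (by simp) (fun x => by
        simp only [Heisenberg.mul_t, Heisenberg.mul_z, wedge, Prod.fst_add, Prod.snd_add,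
          inner_add_left, inner_add_right, inner_sub_right]
        ring) }

theorem coeFn_tSch (ħ : ℝ) (g : Heisenberg N) (ψ : L2 (Conf N)) :
    tSch ħ g ψ =ᵐ[volume] schAction ħ g ψ :=
  coeFn_modTranslate (fun x => 1 / ħ * (g.t + inner ℝ g.z.2 x - 1 / 2 * inner ℝ g.z.2 g.z.1))
    (by fun_prop) g.z.1 ψ

/-- The phase-space representation of the Heisenberg group on `L²(ℝ²ᴺ)`: the unitary operators
`Ψ ↦ phAction ħ g Ψ`. -/
def tPh (ħ : ℝ) : Heisenberg N →* (L2 (Phase N) ≃ₗᵢ[ℂ] L2 (Phase N)) :=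
  unitaryOfIsometric
    { toFun := fun g => modTranslate
        (fun z => 1 / ħ * (g.t - 1 / 2 * wedge z g.z)) (by unfold wedge; fun_prop) g.z
      map_one' := modTranslate_one _ (by simp) (by simp [wedge])
      map_mul' := fun g h => modTranslate_mul _ _ _ (by simp) (fun x => by
        simp only [Heisenberg.mul_t, Heisenberg.mul_z, wedge, Prod.fst_add, Prod.snd_add,
          Prod.fst_sub, Prod.snd_sub,
          inner_add_left, inner_add_right, inner_sub_right, inner_sub_left]
        ring) }

theorem coeFn_tPh (ħ : ℝ) (g : Heisenberg N) (Ψ : L2 (Phase N)) :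
    tPh ħ g Ψ =ᵐ[volume] phAction ħ g Ψ :=
  coeFn_modTranslate (fun z => 1 / ħ * (g.t - 1 / 2 * wedge z g.z)) (by unfold wedge; fun_prop)
    g.z Ψ

/-! ### The Wigner wave-packet transform -/

/-- The Wigner wave-packet transform with window `φ`:
`(2πħ)^{-N/2} e^{(i/2ħ) p·x} ∫ e^{-(i/ħ) p·x'} ψ(x') φ(x - x') dx'`. -/
def wpt (ħ : ℝ) (φ ψ : Conf N → ℂ) (z : Phase N) : ℂ :=
  (((1 / (2 * Real.pi * ħ)) ^ ((N : ℝ) / 2) : ℝ) : ℂ) *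
    Complex.exp (((1 / (2 * ħ) * inner ℝ z.2 z.1 : ℝ) : ℂ) * Complex.I) *
    ∫ x', Complex.exp (((-(1 / ħ * inner ℝ z.2 x') : ℝ) : ℂ) * Complex.I) * ψ x' * φ (z.1 - x')

/-- The integral kernel of the transform, as a function of the variable of integration. -/
def wptKernel (ħ : ℝ) (φ : Conf N → ℂ) (z : Phase N) (x' : Conf N) : ℂ :=
  (((1 / (2 * Real.pi * ħ)) ^ ((N : ℝ) / 2) : ℝ) : ℂ) *
    Complex.exp (((1 / (2 * ħ) * inner ℝ z.2 z.1 : ℝ) : ℂ) * Complex.I) *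
    Complex.exp (((-(1 / ħ * inner ℝ z.2 x') : ℝ) : ℂ) * Complex.I) * φ (z.1 - x')

theorem exists_wptSchwartz (ħ : ℝ) (hħ : 0 < ħ) (φ ψ : 𝓢(Conf N, ℂ)) :
    ∃ f : 𝓢(Phase N, ℂ), ∀ z, f z = wpt ħ φ ψ z := by
  obtain ⟨L, hL⟩ := exists_partialFourierCLM (E := Conf N) (c := 1 / ħ) (by positivity)
  obtain ⟨T, hT⟩ := exists_tensor (E := Conf N) φ
  let e : (Conf N × Conf N) ≃L[ℝ] (Conf N × Conf N) :=
    LinearEquiv.toContinuousLinearEquiv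
      { toFun := fun w => (w.1 - w.2, w.2)
        invFun := fun w => (w.1 + w.2, w.2)
        map_add' := fun v w => by ext1 <;> simp; abel
        map_smul' := fun c w => by ext1 <;> simp [smul_sub]
        left_inv := fun w => by simp
        right_inv := fun w => by simp }
  have he : ∀ w, e w = (w.1 - w.2, w.2) := fun w => rfl
  have hb : Function.HasTemperateGrowth
      (fun z : Phase N => 1 / (2 * ħ) * (inner ℝ z.2 z.1 : ℝ)) := by
    have h2 : Function.HasTemperateGrowth (fun z : Phase N => z.2) :=
      (ContinuousLinearMap.snd ℝ (Conf N) (Conf N)).hasTemperateGrowth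
    have h1 : Function.HasTemperateGrowth (fun z : Phase N => z.1) :=
      (ContinuousLinearMap.fst ℝ (Conf N) (Conf N)).hasTemperateGrowth
    exact (Function.HasTemperateGrowth.const (1 / (2 * ħ))).mul
      ((innerSL ℝ (E := Conf N)).bilinear_hasTemperateGrowth h2 h1)
  have hm : Function.HasTemperateGrowth (fun z : Phase N =>
      (((1 / (2 * Real.pi * ħ)) ^ ((N : ℝ) / 2) : ℝ) : ℂ) *
      Complex.exp (((1 / (2 * ħ) * inner ℝ z.2 z.1 : ℝ) : ℂ) * Complex.I)) :=
    (Function.HasTemperateGrowth.const _).mul (hasTemperateGrowth_cexp_mul_I.comp hb)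
  refine ⟨smulLeftCLM ℂ (fun z : Phase N =>
      (((1 / (2 * Real.pi * ħ)) ^ ((N : ℝ) / 2) : ℝ) : ℂ) *
      Complex.exp (((1 / (2 * ħ) * inner ℝ z.2 z.1 : ℝ) : ℂ) * Complex.I))
    (L (compCLMOfContinuousLinearEquiv ℂ e (T ψ))), fun z => ?_⟩
  rw [smulLeftCLM_apply_apply hm, hL, wpt, smul_eq_mul]
  congr 1
  refine integral_congr_ae (Filter.Eventually.of_forall fun y => ?_)
  simp only [compCLMOfContinuousLinearEquiv_apply, Function.comp_apply, he, hT]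
  ring

/-- The Wigner wave-packet transform of a Schwartz function is a Schwartz function. -/
def wptSchwartz (ħ : ℝ) (hħ : 0 < ħ) (φ ψ : 𝓢(Conf N, ℂ)) : 𝓢(Phase N, ℂ) where
  toFun := wpt ħ φ ψ
  smooth' := by
    obtain ⟨f, hf⟩ := exists_wptSchwartz ħ hħ φ ψ
    rw [← funext hf]
    exact f.smooth ⊤
  decay' := by
    obtain ⟨f, hf⟩ := exists_wptSchwartz ħ hħ φ ψ
    rw [← funext hf]
    exact f.decay'

theorem exists_wptKernelSchwartz (ħ : ℝ) (φ : 𝓢(Conf N, ℂ)) (z : Phase N) :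
    ∃ f : 𝓢(Conf N, ℂ), ∀ x', f x' = wptKernel ħ φ z x' := by
  obtain ⟨g, hg⟩ := exists_schwartz_modulated_reflection
    ((((1 / (2 * Real.pi * ħ)) ^ ((N : ℝ) / 2) : ℝ) : ℂ) *
      Complex.exp (((1 / (2 * ħ) * inner ℝ z.2 z.1 : ℝ) : ℂ) * Complex.I)) 0
    ((-(1 / ħ)) • innerSL ℝ z.2) z.1 φ
  refine ⟨g, fun x' => ?_⟩
  rw [hg, wptKernel]
  simp

/-- The integral kernel of the transform as a Schwartz function. -/
def wptKernelSchwartz (ħ : ℝ) (φ : 𝓢(Conf N, ℂ)) (z : Phase N) : 𝓢(Conf N, ℂ) where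
  toFun := wptKernel ħ φ z
  smooth' := by
    obtain ⟨f, hf⟩ := exists_wptKernelSchwartz ħ φ z
    rw [← funext hf]
    exact f.smooth ⊤
  decay' := by
    obtain ⟨f, hf⟩ := exists_wptKernelSchwartz ħ φ z
    rw [← funext hf]
    exact f.decay'

/-- The Wigner wave-packet transform of a tempered distribution: the distribution is evaluated on
the integral kernel. -/
def wptDist (ħ : ℝ) (φ : 𝓢(Conf N, ℂ)) (T : 𝓢'(Conf N, ℂ)) (z : Phase N) : ℂ :=
  T (wptKernelSchwartz ħ φ z)

/-- On `L²` functions, viewed as tempered distributions, this is the integral transform. -/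
theorem wptDist_toTemperedDistribution (ħ : ℝ) (φ : 𝓢(Conf N, ℂ)) (ψ : L2 (Conf N)) :
    wptDist ħ φ (Lp.toTemperedDistribution ψ) = wpt ħ φ ψ := by
  ext z
  rw [wptDist, Lp.toTemperedDistribution_apply, wpt, ← integral_const_mul]
  refine integral_congr_ae (Filter.Eventually.of_forall fun x => ?_)
  change wptKernel ħ φ z x • ψ x = _
  simp only [wptKernel, smul_eq_mul]
  ring

/-! ### The symplectic Fourier transform -/

/-- The symplectic Fourier transform `(2πħ)^{-N} ∫ e^{-(i/ħ) z ∧ z'} A(z') dz'`. -/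
def symplecticFourier (ħ : ℝ) (A : Phase N → ℂ) (z : Phase N) : ℂ :=
  (((1 / (2 * Real.pi * ħ)) ^ N : ℝ) : ℂ) *
    ∫ z', Complex.exp (((-(1 / ħ * wedge z z') : ℝ) : ℂ) * Complex.I) * A z'

theorem exists_symplecticFourierCLM (ħ : ℝ) (hħ : 0 < ħ) :
    ∃ L : 𝓢(Phase N, ℂ) →L[ℂ] 𝓢(Phase N, ℂ), ∀ f z, L f z = symplecticFourier ħ f z := by
  let e : WithLp 2 (Conf N × Conf N) ≃L[ℝ] Phase N :=
    WithLp.prodContinuousLinearEquiv 2 ℝ (Conf N) (Conf N)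
  let j : Phase N ≃L[ℝ] Phase N :=
    LinearEquiv.toContinuousLinearEquiv
      { toFun := fun w => ((1 / (2 * Real.pi * ħ)) • w.2, -((1 / (2 * Real.pi * ħ)) • w.1))
        invFun := fun w => (-((2 * Real.pi * ħ) • w.2), (2 * Real.pi * ħ) • w.1)
        map_add' := fun v w => by ext1 <;> simp only [Prod.fst_add, Prod.snd_add] <;> module
        map_smul' := fun c w => by
          ext1 <;> simp only [Prod.smul_fst, Prod.smul_snd, RingHom.id_apply] <;> module
        left_inv := fun w => by
          have h : (2 * Real.pi * ħ) * (1 / (2 * Real.pi * ħ)) = 1 := by field_simp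
          ext1 <;> dsimp only <;> simp only [smul_neg, neg_neg, smul_smul, h, one_smul]
        right_inv := fun w => by
          have h : (1 / (2 * Real.pi * ħ)) * (2 * Real.pi * ħ) = 1 := by field_simp
          ext1 <;> dsimp only <;> simp only [smul_neg, neg_neg, smul_smul, h, one_smul] }
  have hj : ∀ w, j w = ((1 / (2 * Real.pi * ħ)) • w.2, -((1 / (2 * Real.pi * ħ)) • w.1)) :=
    fun w => rfl
  refine ⟨(((1 / (2 * Real.pi * ħ)) ^ N : ℝ) : ℂ) •
    (compCLMOfContinuousLinearEquiv ℂ (j.trans e.symm)).comp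
      ((FourierTransform.fourierCLM ℂ 𝓢(WithLp 2 (Conf N × Conf N), ℂ)).comp
        (compCLMOfContinuousLinearEquiv ℂ e)), fun f z => ?_⟩
  simp only [ContinuousLinearMap.comp_apply, _root_.smul_apply]
  rw [symplecticFourier, smul_eq_mul]
  congr 1
  rw [compCLMOfContinuousLinearEquiv_apply, Function.comp_apply,
    FourierTransform.fourierCLM_apply, SchwartzMap.fourier_coe, Real.fourier_eq',
    ← (WithLp.volume_preserving_toLp (Conf N) (Conf N)).integral_comp
      (MeasurableEquiv.toLp 2 (Conf N × Conf N)).measurableEmbedding]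
  refine integral_congr_ae (Filter.Eventually.of_forall fun w => ?_)
  simp only [smul_eq_mul, compCLMOfContinuousLinearEquiv_apply, Function.comp_apply]
  congr 1
  have hj' : (j.trans e.symm) z = WithLp.toLp 2 (j z) := rfl
  rw [hj', hj]
  congr 3
  simp only [WithLp.prod_inner_apply, inner_smul_right, inner_neg_right, wedge]
  rw [real_inner_comm z.2 w.1]
  have := Real.pi_ne_zero
  field_simp
  ring

/-- The symplectic Fourier transform on Schwartz functions. -/
def symplecticFourierCLM (ħ : ℝ) (hħ : 0 < ħ) : 𝓢(Phase N, ℂ) →L[ℂ] 𝓢(Phase N, ℂ) :=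
  (exists_symplecticFourierCLM ħ hħ).choose

theorem symplecticFourierCLM_apply (ħ : ℝ) (hħ : 0 < ħ) (f : 𝓢(Phase N, ℂ)) (z : Phase N) :
    symplecticFourierCLM ħ hħ f z = symplecticFourier ħ f z :=
  (exists_symplecticFourierCLM ħ hħ).choose_spec f z

/-- The symplectic Fourier transform of a tempered distribution, by duality:
`⟨F_σ A, f⟩ = ⟨A, z ↦ (F_σ f)(-z)⟩`, since `-(z ∧ z') = z' ∧ z`. -/
def symplecticFourierDist (ħ : ℝ) (hħ : 0 < ħ) (A : 𝓢'(Phase N, ℂ)) : 𝓢'(Phase N, ℂ) :=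
  PointwiseConvergenceCLM.precomp ℂ
    ((compCLMOfContinuousLinearEquiv ℂ (ContinuousLinearEquiv.neg ℝ)).comp
      (symplecticFourierCLM ħ hħ)) A

/-! ### Weyl operators -/

theorem exists_ambiguityCLM (ħ : ℝ) (hħ : 0 < ħ) (ψ : 𝓢(Conf N, ℂ)) :
    ∃ L : 𝓢(Conf N, ℂ) →L[ℂ] 𝓢(Phase N, ℂ), ∀ χ z₀,
      L χ z₀ = ∫ x, schAction ħ ⟨z₀, 0⟩ ψ x * χ x := by
  obtain ⟨L, hL⟩ := exists_partialFourierCLM (E := Conf N) (c := -(1 / ħ))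
    (neg_ne_zero.2 (by positivity))
  obtain ⟨T, hT⟩ := exists_tensor (E := Conf N) ψ
  let e : (Conf N × Conf N) ≃L[ℝ] (Conf N × Conf N) :=
    LinearEquiv.toContinuousLinearEquiv
      { toFun := fun w => (w.2 - (1 / 2 : ℝ) • w.1, w.2 + (1 / 2 : ℝ) • w.1)
        invFun := fun w => (w.2 - w.1, (1 / 2 : ℝ) • (w.1 + w.2))
        map_add' := fun v w => by ext1 <;> simp only [Prod.fst_add, Prod.snd_add] <;> module
        map_smul' := fun c w => by
          ext1 <;> simp only [Prod.smul_fst, Prod.smul_snd, RingHom.id_apply] <;> module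
        left_inv := fun w => by ext1 <;> dsimp only <;> module
        right_inv := fun w => by ext1 <;> dsimp only <;> module }
  have he : ∀ w, e w = (w.2 - (1 / 2 : ℝ) • w.1, w.2 + (1 / 2 : ℝ) • w.1) := fun w => rfl
  refine ⟨L.comp ((compCLMOfContinuousLinearEquiv ℂ e).comp T), fun χ z₀ => ?_⟩
  rw [← integral_add_right_eq_self _ ((1 / 2 : ℝ) • z₀.1)]
  simp only [ContinuousLinearMap.comp_apply]
  rw [hL]
  refine integral_congr_ae (Filter.Eventually.of_forall fun y => ?_)
  simp only [compCLMOfContinuousLinearEquiv_apply, Function.comp_apply, he, hT, schAction]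
  have h1 : y + (1 / 2 : ℝ) • z₀.1 - z₀.1 = y - (1 / 2 : ℝ) • z₀.1 := by module
  rw [h1, mul_assoc]
  congr 3
  rw [inner_add_right, inner_smul_right]
  push_cast
  ring

/-- The function `z₀ ↦ ∫ (T_Sch(z₀) ψ)(x) χ(x) dx`, as a continuous linear operator in `χ`. -/
def ambiguityCLM (ħ : ℝ) (hħ : 0 < ħ) (ψ : 𝓢(Conf N, ℂ)) :
    𝓢(Conf N, ℂ) →L[ℂ] 𝓢(Phase N, ℂ) :=
  (exists_ambiguityCLM ħ hħ ψ).choose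

theorem ambiguityCLM_apply (ħ : ℝ) (hħ : 0 < ħ) (ψ χ : 𝓢(Conf N, ℂ)) (z₀ : Phase N) :
    ambiguityCLM ħ hħ ψ χ z₀ = ∫ x, schAction ħ ⟨z₀, 0⟩ ψ x * χ x :=
  (exists_ambiguityCLM ħ hħ ψ).choose_spec χ z₀

/-- The Weyl operator `A_Sch = (2πħ)^{-N} ∫ (F_σ A)(z₀) T_Sch(z₀) dz₀` of a symbol `A`, which may be
any tempered distribution. It maps Schwartz functions to tempered distributions, and the integral is
read weakly: `⟨A_Sch ψ, χ⟩ = (2πħ)^{-N} ⟨F_σ A, z₀ ↦ ⟨T_Sch(z₀) ψ, χ⟩⟩`. -/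
def weylSch (ħ : ℝ) (hħ : 0 < ħ) (A : 𝓢'(Phase N, ℂ)) (ψ : 𝓢(Conf N, ℂ)) : 𝓢'(Conf N, ℂ) :=
  (((1 / (2 * Real.pi * ħ)) ^ N : ℝ) : ℂ) •
    PointwiseConvergenceCLM.precomp ℂ (ambiguityCLM ħ hħ ψ) (symplecticFourierDist ħ hħ A)

theorem exists_phOrbit (ħ : ℝ) (Ψ : 𝓢(Phase N, ℂ)) (z : Phase N) :
    ∃ f : 𝓢(Phase N, ℂ), ∀ z₀, f z₀ = phAction ħ ⟨z₀, 0⟩ Ψ z := by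
  obtain ⟨g, hg⟩ := exists_schwartz_modulated_reflection 1 0
    ((-(1 / (2 * ħ))) • ((innerSL ℝ z.2).comp (ContinuousLinearMap.fst ℝ (Conf N) (Conf N)) -
      (innerSL ℝ z.1).comp (ContinuousLinearMap.snd ℝ (Conf N) (Conf N)))) z Ψ
  refine ⟨g, fun z₀ => ?_⟩
  rw [hg, phAction]
  congr 1
  rw [one_mul]
  congr 3
  simp [wedge, real_inner_comm]
  ring

/-- For fixed `z`, the function `z₀ ↦ (T_ph(z₀) Ψ)(z)`. -/
def phOrbit (ħ : ℝ) (Ψ : 𝓢(Phase N, ℂ)) (z : Phase N) : 𝓢(Phase N, ℂ) where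
  toFun z₀ := phAction ħ ⟨z₀, 0⟩ Ψ z
  smooth' := by
    obtain ⟨f, hf⟩ := exists_phOrbit ħ Ψ z
    rw [← funext hf]
    exact f.smooth ⊤
  decay' := by
    obtain ⟨f, hf⟩ := exists_phOrbit ħ Ψ z
    rw [← funext hf]
    exact f.decay'

/-- The phase-space Weyl operator `(A_ph Ψ)(z) = (2πħ)^{-N} ∫ (F_σ A)(z₀) (T_ph(z₀) Ψ)(z) dz₀` of a
symbol `A`, which may be any tempered distribution: for each `z` the distribution `F_σ A` is
evaluated on the Schwartz function `z₀ ↦ (T_ph(z₀) Ψ)(z)`. -/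
def weylPh (ħ : ℝ) (hħ : 0 < ħ) (A : 𝓢'(Phase N, ℂ)) (Ψ : 𝓢(Phase N, ℂ)) (z : Phase N) : ℂ :=
  (((1 / (2 * Real.pi * ħ)) ^ N : ℝ) : ℂ) * symplecticFourierDist ħ hħ A (phOrbit ħ Ψ z)

/-- The vector-valued (Bochner) form `(2πħ)^{-N} ∫ (F_σ A)(z₀) π(z₀) v dz₀` of the Weyl operator with
symbol `A` attached to a representation `π`. -/
def weylBochner {H : Type} [NormedAddCommGroup H] [InnerProductSpace ℂ H] (ħ : ℝ)
    (π : Heisenberg N →* (H ≃ₗᵢ[ℂ] H)) (A : Phase N → ℂ) (v : H) : H :=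
  (((1 / (2 * Real.pi * ħ)) ^ N : ℝ) : ℂ) • ∫ z₀, symplecticFourier ħ A z₀ • π ⟨z₀, 0⟩ v

end

end PhaseSpaceWeyl

open PhaseSpaceWeyl

namespace PhaseSpaceWeyl

/-! ### Kernel form and covariance of the wave-packet transform. -/

variable {N : ℕ}

/-! Write the transform as `(U ψ)(z) = ∫ K_z ψ`, where `K_z` is the Schwartz function `wptKernel ħ φ
z`. The core is the pointwise covariance `phAction_wpt`: a translation of the integration variable
moves the phase-space action from `U ψ` onto `ψ`. It gives `T_ph U = U T_Sch` on `L²` at once. It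
also says that, for fixed `z`, the function `z₀ ↦ (T_ph(z₀) U ψ)(z)` is the same Schwartz function
as `z₀ ↦ ∫ (T_Sch(z₀) ψ) K_z`. Both sides of the Weyl identity at `z` are the value of `F_σ A` on
this one function, so they agree for every tempered `A` (`weylPh_wptSchwartz`). Density of Schwartz
functions then gives the bounded extensions, and commuting `U` with the integral gives the Bochner
form.

Isometry: for fixed `x`, `p ↦ (U ψ)(x, p)` is, up to a phase and scaling, the Fourier transform of
`y ↦ ψ(y) φ(x - y)`. Plancherel in `p` and integration in `x` leave the integral of the convolution
of `|ψ|²` with `|φ|²`, which is `‖ψ‖² ‖φ‖²` (`integral_norm_sq_wpt`). The isometry on Schwartz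
functions extends to `L²`, and continuity of `ψ ↦ (U ψ)(z)` at each `z` shows that the extension is
still the integral transform.

Irreducibility is proved for `tSch`: if all coefficients `⟨χ, T_Sch(g) ψ⟩` vanish, Fourier
uniqueness in momentum gives `ψ(x - a) conj(χ(x)) = 0` almost everywhere for each `a`, and
integrating over `a` forces `‖χ‖ ‖ψ‖ = 0`. The unitary map from `L²` onto the range of `U` carries
this over to phase space. -/

theorem wpt_congr {ħ : ℝ} {φ ψ ψ' : Conf N → ℂ} (h : ψ =ᵐ[volume] ψ') :
    wpt ħ φ ψ = wpt ħ φ ψ' := by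
  ext z
  rw [wpt, wpt]
  congr 1
  refine integral_congr_ae ?_
  filter_upwards [h] with x hx
  rw [hx]

theorem wpt_eq_integral_kernel (ħ : ℝ) (φ ψ : Conf N → ℂ) (z : Phase N) :
    wpt ħ φ ψ z = ∫ x, wptKernel ħ φ z x * ψ x := by
  rw [wpt, ← integral_const_mul]
  refine integral_congr_ae (Filter.Eventually.of_forall fun x => ?_)
  simp only [wptKernel]
  ring

/-- At a fixed `z` the transform is the pairing with one Schwartz function, which is continuous in
the `L²` norm. This identifies the abstract extension of the transform to `L²` with the integral
formula. -/
theorem continuous_wpt_apply (ħ : ℝ) (φ : 𝓢(Conf N, ℂ)) (z : Phase N) :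
    Continuous fun ψ : L2 (Conf N) => wpt ħ φ ψ z := by
  simp_rw [← wptDist_toTemperedDistribution, wptDist]
  exact (PointwiseConvergenceCLM.evalCLM (RingHom.id ℂ) ℂ (wptKernelSchwartz ħ φ z)).continuous.comp
    (Lp.toTemperedDistributionCLM ℂ volume 2).continuous

/-- The transform intertwines the two actions pointwise. -/
theorem phAction_wpt (ħ : ℝ) (φ ψ : Conf N → ℂ) (g : Heisenberg N) (z : Phase N) :
    phAction ħ g (wpt ħ φ ψ) z = wpt ħ φ (schAction ħ g ψ) z := by
  have h : (∫ x', Complex.exp (((-(1 / ħ * inner ℝ z.2 x') : ℝ) : ℂ) * Complex.I) *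
        schAction ħ g ψ x' * φ (z.1 - x')) =
      Complex.exp (((1 / ħ * (g.t + 1 / 2 * inner ℝ g.z.2 g.z.1 - inner ℝ z.2 g.z.1) : ℝ) : ℂ)
        * Complex.I) *
      ∫ x', Complex.exp (((-(1 / ħ * inner ℝ (z - g.z).2 x') : ℝ) : ℂ) * Complex.I) *
        ψ x' * φ ((z - g.z).1 - x') := by
    -- Substituting `x' = x + x₀`, the combined phase splits into the part linear in `x`, with
    -- momentum `p - p₀`, and the constant `t₀ + ½ p₀·x₀ - p·x₀`.
    rw [← integral_const_mul, ← integral_add_right_eq_self _ g.z.1]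
    refine integral_congr_ae (Filter.Eventually.of_forall fun x => ?_)
    simp only [schAction, add_sub_cancel_right]
    rw [← mul_assoc, ← mul_assoc, ← mul_assoc, ← Complex.exp_add, ← Complex.exp_add,
      Prod.fst_sub, Prod.snd_sub, sub_sub, add_comm g.z.1 x]
    congr 3
    rw [← add_mul, ← add_mul]
    congr 1
    simp only [inner_add_right, inner_sub_left]
    push_cast
    ring
  rw [phAction, wpt, wpt, h]
  simp only [← mul_assoc]
  congr 1
  rw [mul_comm (Complex.exp _) (Complex.ofReal _), mul_assoc (Complex.ofReal _),
    mul_assoc (Complex.ofReal _), ← Complex.exp_add, ← Complex.exp_add, ← add_mul, ← add_mul]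
  congr 3
  -- What remains is `t₀ - ½ z ∧ z₀ + ½ (p - p₀)·(x - x₀) = ½ p·x + t₀ + ½ p₀·x₀ - p·x₀`, divided by
  -- `ħ`.
  simp only [wedge, Prod.fst_sub, Prod.snd_sub, inner_sub_right, inner_sub_left]
  push_cast
  -- For `ħ = 0` the convention `1 / 0 = 0` makes every phase vanish.
  rcases eq_or_ne ħ 0 with rfl | hħ
  · simp
  have : (ħ : ℂ) ≠ 0 := by exact_mod_cast hħ
  field_simp
  ring

/-! ### Plancherel identity and the isometry on `L²`. -/

theorem exists_schwartz_mul_reflection (φ ψ : 𝓢(Conf N, ℂ)) (x : Conf N) :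
    ∃ s : 𝓢(Conf N, ℂ), ∀ y, s y = ψ y * φ (x - y) := by
  obtain ⟨g, hg⟩ := exists_schwartz_modulated_reflection 1 0 0 x φ
  refine ⟨smulLeftCLM ℂ ψ g, fun y => ?_⟩
  rw [smulLeftCLM_apply_apply ψ.hasTemperateGrowth, hg]
  simp

/-- The frequency `p / (2πħ)` converts the phase `p·y/ħ` to the convention `e^{-2πi w·y}`. Keeping
`s` abstract allows it to be a Schwartz function, for which Plancherel is applied next. -/
theorem wpt_eq_fourier (ħ : ℝ) {φ ψ : Conf N → ℂ} (x p : Conf N) {s : Conf N → ℂ}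
    (hs : ∀ y, s y = ψ y * φ (x - y)) :
    wpt ħ φ ψ (x, p) = (((1 / (2 * Real.pi * ħ)) ^ ((N : ℝ) / 2) : ℝ) : ℂ) *
      Complex.exp (((1 / (2 * ħ) * inner ℝ p x : ℝ) : ℂ) * Complex.I) *
      𝓕 s ((1 / (2 * Real.pi * ħ)) • p) := by
  rw [wpt, Real.fourier_eq']
  congr 1
  refine integral_congr_ae (Filter.Eventually.of_forall fun y => ?_)
  simp only [hs, smul_eq_mul, mul_assoc]
  congr 3
  rw [inner_smul_right, real_inner_comm]
  have := Real.pi_ne_zero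
  push_cast
  field_simp

/-- Plancherel in `p`: the squared normalisation `(2πħ)^{-N}` exactly cancels the Jacobian of `w = p
/ (2πħ)` in dimension `N`. -/
theorem integral_norm_sq_wpt_snd (ħ : ℝ) (hħ : 0 < ħ) (φ ψ : 𝓢(Conf N, ℂ)) (x : Conf N) :
    ∫ p, ‖wpt ħ φ ψ (x, p)‖ ^ 2 = ∫ y, ‖ψ y‖ ^ 2 * ‖φ (x - y)‖ ^ 2 := by
  obtain ⟨s, hs⟩ := exists_schwartz_mul_reflection φ ψ x
  have hr : (0 : ℝ) < 1 / (2 * Real.pi * ħ) := by positivity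
  have h : ∀ p, ‖wpt ħ φ ψ (x, p)‖ ^ 2 =
      (1 / (2 * Real.pi * ħ)) ^ N * ‖(𝓕 s) ((1 / (2 * Real.pi * ħ)) • p)‖ ^ 2 := by
    intro p
    rw [wpt_eq_fourier ħ x p hs, norm_mul, norm_mul, Complex.norm_exp_ofReal_mul_I, mul_one,
      Complex.norm_real, Real.norm_of_nonneg (by positivity), mul_pow, ← Real.rpow_natCast,
      ← Real.rpow_mul hr.le, SchwartzMap.fourier_coe]
    norm_num
  simp_rw [h]
  rw [integral_const_mul, Measure.integral_comp_smul volume (fun p => ‖(𝓕 s : 𝓢(Conf N, ℂ)) p‖ ^ 2),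
    SchwartzMap.integral_norm_sq_fourier, finrank_euclideanSpace_fin, smul_eq_mul, ← mul_assoc,
    abs_of_pos (by positivity), mul_inv_cancel₀ (by positivity), one_mul]
  simp_rw [hs, norm_mul, mul_pow]

theorem integrable_norm_sq {E : Type} [NormedAddCommGroup E] [NormedSpace ℝ E]
    [MeasurableSpace E] [BorelSpace E] [SecondCountableTopology E] {μ : Measure E}
    [μ.HasTemperateGrowth] (f : 𝓢(E, ℂ)) :
    Integrable (fun x => ‖f x‖ ^ 2) μ :=
  (memLp_two_iff_integrable_sq_norm (f.memLp 2 μ).1).1 (f.memLp 2 μ)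

theorem integral_norm_sq_wpt (ħ : ℝ) (hħ : 0 < ħ) (φ ψ : 𝓢(Conf N, ℂ)) :
    ∫ z, ‖wpt ħ φ ψ z‖ ^ 2 = (∫ x, ‖ψ x‖ ^ 2) * ∫ x, ‖φ x‖ ^ 2 := by
  have hi : Integrable (fun z : Phase N => ‖wpt ħ φ ψ z‖ ^ 2)
      (volume : Measure (Phase N)) := integrable_norm_sq (wptSchwartz ħ hħ φ ψ)
  rw [show (volume : Measure (Phase N)) = (volume : Measure (Conf N)).prod volume from rfl,
    integral_prod _ hi]
  simp_rw [integral_norm_sq_wpt_snd ħ hħ]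
  -- After Fubini the integrand in `x` is the convolution of `|ψ|²` and `|φ|²`, whose integral is
  -- the product of the integrals.
  exact integral_convolution (ContinuousLinearMap.mul ℝ ℝ) (integrable_norm_sq ψ)
    (integrable_norm_sq φ)

theorem norm_toLp_sq {E : Type} [NormedAddCommGroup E] [NormedSpace ℝ E]
    [FiniteDimensional ℝ E] [MeasureSpace E] [BorelSpace E]
    [(volume : Measure E).HasTemperateGrowth] (f : 𝓢(E, ℂ)) :
    ‖f.toLp 2‖ ^ 2 = ∫ x, ‖f x‖ ^ 2 := by
  have h := SchwartzMap.inner_toL2_toL2_eq f f volume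
  rw [inner_self_eq_norm_sq_to_K] at h
  have h2 : (∫ x, inner ℂ (f x) (f x)) = ((∫ x, ‖f x‖ ^ 2 : ℝ) : ℂ) := by
    rw [← integral_complex_ofReal]
    refine integral_congr_ae (Filter.Eventually.of_forall fun x => ?_)
    simp only [inner_self_eq_norm_sq_to_K]
    simp
  rw [h2] at h
  refine Complex.ofReal_injective ?_
  rw [← h]
  simp

theorem norm_toLp_wptSchwartz (ħ : ℝ) (hħ : 0 < ħ) {φ : 𝓢(Conf N, ℂ)}
    (hφ : ∫ x, ‖φ x‖ ^ 2 = 1) (ψ : 𝓢(Conf N, ℂ)) :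
    ‖(wptSchwartz ħ hħ φ ψ).toLp 2‖ = ‖ψ.toLp 2‖ := by
  rw [← sq_eq_sq₀ (norm_nonneg _) (norm_nonneg _), norm_toLp_sq, norm_toLp_sq]
  exact (integral_norm_sq_wpt ħ hħ φ ψ).trans (by rw [hφ, mul_one])

theorem integrable_wptKernel_mul (ħ : ℝ) (φ ψ : 𝓢(Conf N, ℂ)) (z : Phase N) :
    Integrable fun x => wptKernel ħ φ z x * ψ x :=
  ((wptKernelSchwartz ħ φ z).memLp 2).integrable_mul (ψ.memLp 2)

theorem dense_schwartz : DenseRange fun ψ : 𝓢(Conf N, ℂ) => (ψ.toLp 2 : L2 (Conf N)) :=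
  SchwartzMap.denseRange_toLpCLM (by simp)

/-- The transform is a linear isometry of `L²`. -/
theorem exists_wptIsometry (ħ : ℝ) (hħ : 0 < ħ) {φ : 𝓢(Conf N, ℂ)} (hφ : ∫ x, ‖φ x‖ ^ 2 = 1) :
    ∃ U : L2 (Conf N) →ₗᵢ[ℂ] L2 (Phase N), ∀ ψ, U ψ =ᵐ[volume] wpt ħ φ ψ := by
  let W : 𝓢(Conf N, ℂ) →ₗ[ℂ] L2 (Phase N) :=
    (toLpCLM ℂ ℂ 2 (volume : Measure (Phase N))).toLinearMap ∘ₗ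
      { toFun := wptSchwartz ħ hħ φ
        map_add' := fun ψ χ => by
          ext z
          change wpt ħ φ (ψ + χ : 𝓢(Conf N, ℂ)) z = wpt ħ φ ψ z + wpt ħ φ χ z
          simp_rw [wpt_eq_integral_kernel]
          rw [← integral_add (integrable_wptKernel_mul ħ φ ψ z) (integrable_wptKernel_mul ħ φ χ z)]
          simp [mul_add]
        map_smul' := fun c ψ => by
          ext z
          change wpt ħ φ (c • ψ : 𝓢(Conf N, ℂ)) z = c * wpt ħ φ ψ z
          simp_rw [wpt_eq_integral_kernel]
          rw [← integral_const_mul]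
          simp [mul_left_comm] }
  let e : 𝓢(Conf N, ℂ) →ₗ[ℂ] L2 (Conf N) :=
    (toLpCLM ℂ ℂ 2 (volume : Measure (Conf N))).toLinearMap
  have he : DenseRange e := dense_schwartz
  have hW : ∀ ψ, ‖W ψ‖ = ‖e ψ‖ := norm_toLp_wptSchwartz ħ hħ hφ
  have hV : ∀ ψ, W.extendOfNorm e (e ψ) = W ψ :=
    LinearMap.extendOfNorm_eq he ⟨1, fun ψ => by rw [one_mul, hW]⟩
  refine ⟨⟨(W.extendOfNorm e).toLinearMap, fun ψ => ?_⟩, fun ψ => ?_⟩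
  · refine he.induction_on (p := fun ψ => ‖W.extendOfNorm e ψ‖ = ‖ψ‖) ψ
      (isClosed_eq (by fun_prop) (by fun_prop)) fun ψ => ?_
    rw [hV, hW]
  -- Approximate `ψ` in `L²` by Schwartz functions. Their images converge in `L²`, hence almost
  -- everywhere along a subsequence, while their integral transforms converge at every `z` by
  -- `continuous_wpt_apply`. Uniqueness of limits identifies the two.
  · obtain ⟨u, hu, hlim⟩ := mem_closure_iff_seq_limit.1 (he ψ)
    choose s hs using hu
    have hU : Filter.Tendsto (fun n => W (s n)) Filter.atTop (nhds (W.extendOfNorm e ψ)) := by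
      simp_rw [← hV, hs]
      exact ((W.extendOfNorm e).continuous.tendsto _).comp hlim
    obtain ⟨k, hk, hae⟩ := (tendstoInMeasure_of_tendsto_Lp hU).exists_seq_tendsto_ae
    have hW' : ∀ᵐ z, ∀ n, W (s n) z = wpt ħ φ (s n) z :=
      ae_all_iff.2 fun n => (wptSchwartz ħ hħ φ (s n)).coeFn_toLp 2 volume
    filter_upwards [hae, hW'] with z hz hz'
    refine tendsto_nhds_unique hz ?_
    have hc := ((continuous_wpt_apply ħ φ z).tendsto ψ).comp (hlim.comp hk.tendsto_atTop)
    refine hc.congr fun n => ?_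
    rw [hz', Function.comp_apply, Function.comp_apply, ← hs]
    exact congrFun (wpt_congr ((s (k n)).coeFn_toLp 2 volume)) z

/-! ### Strong continuity of modulated translations. -/

section StrongContinuity

theorem integrable_norm_sq_L2 {X : Type} [MeasureSpace X] (f : L2 X) : Integrable (fun x => ‖f x‖ ^ 2) (volume : Measure X) :=
  (memLp_two_iff_integrable_sq_norm (Lp.memLp f).1).1 (Lp.memLp f)

theorem norm_sq_L2 {X : Type} [MeasureSpace X] (f : L2 X) : ‖f‖ ^ 2 = ∫ x, ‖f x‖ ^ 2 := by
  have h := L2.inner_def (𝕜 := ℂ) f f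
  simp_rw [inner_self_eq_norm_sq_to_K] at h
  refine Complex.ofReal_injective ?_
  rw [← integral_complex_ofReal]
  simpa using h

variable {X : Type} [NormedAddCommGroup X] [MeasureSpace X] [BorelSpace X]
  [(volume : Measure X).IsAddRightInvariant]
  {G : Type} [TopologicalSpace G] [FirstCountableTopology G]

/-- Dominated convergence applied to `|e^{iθ_g} - e^{iθ_{g₀}}|² |f|²`, with majorant `4 |f|²`
because two unit complex numbers differ by at most `2`. First countability of `G` makes the
neighbourhood filters countably generated, as dominated convergence requires. -/
theorem continuous_modulation {θ : G → X → ℝ} (hθ : ∀ g, Continuous (θ g))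
    (hθ' : ∀ x, Continuous fun g => θ g x) (f : L2 X) :
    Continuous fun g => modTranslate (θ g) (hθ g) 0 f := by
  refine continuous_iff_continuousAt.2 fun g₀ => ?_
  have hsq : ∀ g, ‖modTranslate (θ g) (hθ g) 0 f - modTranslate (θ g₀) (hθ g₀) 0 f‖ ^ 2 =
      ∫ x, ‖Complex.exp ((θ g x : ℂ) * Complex.I) - Complex.exp ((θ g₀ x : ℂ) * Complex.I)‖ ^ 2 *
        ‖f x‖ ^ 2 := by
    intro g
    rw [norm_sq_L2]
    refine integral_congr_ae ?_
    filter_upwards [Lp.coeFn_sub (modTranslate (θ g) (hθ g) 0 f)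
      (modTranslate (θ g₀) (hθ g₀) 0 f), coeFn_modTranslate (θ g) (hθ g) 0 f,
      coeFn_modTranslate (θ g₀) (hθ g₀) 0 f] with x h h₁ h₂
    rw [h, Pi.sub_apply, h₁, h₂, ← sub_mul, norm_mul, mul_pow, sub_zero]
  have hlim : Filter.Tendsto (fun g => ∫ x, ‖Complex.exp ((θ g x : ℂ) * Complex.I) -
      Complex.exp ((θ g₀ x : ℂ) * Complex.I)‖ ^ 2 * ‖f x‖ ^ 2) (nhds g₀)
      (nhds (∫ _ : X, (0 : ℝ))) := by
    refine tendsto_integral_filter_of_dominated_convergence (fun x => 4 * ‖f x‖ ^ 2)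
      (Filter.Eventually.of_forall fun g => ?_)
      (Filter.Eventually.of_forall fun g => Filter.Eventually.of_forall fun x => ?_)
      ((integrable_norm_sq_L2 f).const_mul 4) (Filter.Eventually.of_forall fun x => ?_)
    · exact AEStronglyMeasurable.mul
        (Measurable.aestronglyMeasurable (by
          have := (hθ g).measurable
          have := (hθ g₀).measurable
          fun_prop))
        (integrable_norm_sq_L2 f).1
    · rw [Real.norm_of_nonneg (by positivity)]
      gcongr
      have h := norm_sub_le (Complex.exp ((θ g x : ℂ) * Complex.I))
        (Complex.exp ((θ g₀ x : ℂ) * Complex.I))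
      rw [Complex.norm_exp_ofReal_mul_I, Complex.norm_exp_ofReal_mul_I] at h
      nlinarith [norm_nonneg (Complex.exp ((θ g x : ℂ) * Complex.I) -
        Complex.exp ((θ g₀ x : ℂ) * Complex.I))]
    · have hc : Continuous fun g => ‖Complex.exp ((θ g x : ℂ) * Complex.I) -
          Complex.exp ((θ g₀ x : ℂ) * Complex.I)‖ ^ 2 * ‖f x‖ ^ 2 := by
        have := hθ' x
        fun_prop
      simpa using hc.tendsto g₀
  rw [ContinuousAt, tendsto_iff_norm_sub_tendsto_zero]
  simp_rw [← hsq, integral_zero] at hlim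
  simpa [Real.sqrt_sq] using hlim.sqrt

theorem modTranslate_eq_modulation (θ : X → ℝ) (hθ : Continuous θ) (a : X) (f : L2 X) :
    modTranslate θ hθ a f = modTranslate θ hθ 0
      (Lp.compMeasurePreserving (· - a) (measurePreserving_sub_right volume a) f) := by
  refine Lp.ext ?_
  filter_upwards [coeFn_modTranslate θ hθ a f, coeFn_modTranslate θ hθ 0
      (Lp.compMeasurePreserving (· - a) (measurePreserving_sub_right volume a) f),
    Lp.coeFn_compMeasurePreserving f (measurePreserving_sub_right volume a)] with x h h₁ h₂
  rw [h, h₁, sub_zero, h₂, Function.comp_apply]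

/-- A continuous family of modulated translations is strongly continuous. -/
theorem continuous_modTranslate [IsLocallyFiniteMeasure (volume : Measure X)]
    [(volume : Measure X).InnerRegularCompactLTTop]
    {θ : G → X → ℝ} (hθ : ∀ g, Continuous (θ g))
    (hθ' : ∀ x, Continuous fun g => θ g x) {a : G → X} (ha : Continuous a) (f : L2 X) :
    Continuous fun g => modTranslate (θ g) (hθ g) (a g) f := by
  -- The translations form a continuous family in the compact-open topology, the form in which
  -- continuity of composition on `L²` is available.
  let c : C(G, C(X, X)) := ContinuousMap.curry ⟨fun w : G × X => w.2 - a w.1, by fun_prop⟩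
  have hτ : Continuous fun g =>
      Lp.compMeasurePreserving (· - a g) (measurePreserving_sub_right volume (a g)) f :=
    (continuous_const (y := f)).compMeasurePreservingLp c.continuous
      (fun g => measurePreserving_sub_right volume (a g)) (by simp)
  simp_rw [fun g => modTranslate_eq_modulation (θ g) (hθ g) (a g) f]
  refine continuous_iff_continuousAt.2 fun g₀ => ?_
  set τ := fun g => Lp.compMeasurePreserving (· - a g) (measurePreserving_sub_right volume (a g)) f
  rw [ContinuousAt, tendsto_iff_norm_sub_tendsto_zero]
  have h₁ := tendsto_iff_norm_sub_tendsto_zero.1 (hτ.tendsto g₀)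
  have h₂ := tendsto_iff_norm_sub_tendsto_zero.1
    ((continuous_modulation hθ hθ' (τ g₀)).tendsto g₀)
  -- With `M_g` the modulation, `M_g τ_g - M_{g₀} τ_{g₀} = M_g (τ_g - τ_{g₀}) + (M_g - M_{g₀})
  -- τ_{g₀}`. The first term has norm `‖τ_g - τ_{g₀}‖` since `M_g` is isometric; the second is a
  -- modulation of a fixed vector.
  refine squeeze_zero (fun _ => norm_nonneg _) (fun g => ?_) (by simpa using h₁.add h₂)
  rw [← (modTranslate (θ g) (hθ g) 0).norm_map (τ g - τ g₀), map_sub]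
  exact norm_sub_le_norm_sub_add_norm_sub _ _ _

end StrongContinuity

theorem Heisenberg.isInducing_coordinates :
    Topology.IsInducing fun g : Heisenberg N => (g.z, g.t) := ⟨rfl⟩

instance : FirstCountableTopology (Heisenberg N) :=
  Heisenberg.isInducing_coordinates.firstCountableTopology

theorem Heisenberg.continuous_z : Continuous fun g : Heisenberg N => g.z :=
  continuous_fst.comp Heisenberg.isInducing_coordinates.continuous

theorem Heisenberg.continuous_t : Continuous fun g : Heisenberg N => g.t :=
  continuous_snd.comp Heisenberg.isInducing_coordinates.continuous

theorem continuous_tSch (ħ : ℝ) (ψ : L2 (Conf N)) : Continuous fun g => tSch ħ g ψ := by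
  have hz := Heisenberg.continuous_z (N := N)
  have ht := Heisenberg.continuous_t (N := N)
  let θ : Heisenberg N → Conf N → ℝ :=
    fun g x => 1 / ħ * (g.t + inner ℝ g.z.2 x - 1 / 2 * inner ℝ g.z.2 g.z.1)
  have hθ : ∀ g, Continuous (θ g) := fun g => by fun_prop
  have hθ' : ∀ x, Continuous fun g => θ g x := fun x => by fun_prop
  have key : ∀ g, tSch ħ g ψ = modTranslate (θ g) (hθ g) g.z.1 ψ := fun g => rfl
  simp_rw [key]
  exact continuous_modTranslate hθ hθ' hz.fst ψ

/-! ### Irreducibility of the Schrödinger representation. -/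

/-- An integrable function whose Fourier transform vanishes is zero. -/
theorem ae_eq_zero_of_fourier_eq_zero {h : Conf N → ℂ} (hi : Integrable h)
    (h0 : ∀ w, 𝓕 h w = 0) : h =ᵐ[volume] 0 := by
  have hT : Lp.toTemperedDistributionCLM ℂ (volume : Measure (Conf N)) 1
      ((memLp_one_iff_integrable.2 hi).toLp h) = 0 := by
    ext s
    -- Every test function is some `𝓕 s`, and `∫ 𝓕 s · h = ∫ s · 𝓕 h = 0`. Thus `h` vanishes as a
    -- tempered distribution, and the embedding of `L¹` is injective.
    obtain ⟨s, rfl⟩ : ∃ s' : 𝓢(Conf N, ℂ), 𝓕 s' = s :=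
      ⟨𝓕⁻ s, FourierTransform.fourier_fourierInv_eq s⟩
    rw [Lp.toTemperedDistributionCLM_apply, Lp.toTemperedDistribution_apply]
    have h1 : (∫ x, (𝓕 s) x • (memLp_one_iff_integrable.2 hi).toLp h x) = ∫ x, 𝓕 (⇑s) x • h x := by
      refine integral_congr_ae ?_
      filter_upwards [(memLp_one_iff_integrable.2 hi).coeFn_toLp] with x hx
      rw [hx, SchwartzMap.fourier_coe]
    rw [h1]
    have h2 := VectorFourier.integral_fourierIntegral_smul_eq_flip (L := innerₗ (Conf N))
      Real.continuous_fourierChar continuous_inner (s.integrable (μ := volume)) hi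
    rw [flip_innerₗ] at h2
    refine h2.trans ?_
    have h3 : ∀ w, VectorFourier.fourierIntegral Real.fourierChar volume (innerₗ (Conf N)) h w
        = 0 := h0
    simp [h3]
  have hk : (memLp_one_iff_integrable.2 hi).toLp h ∈
      (Lp.toTemperedDistributionCLM ℂ (volume : Measure (Conf N)) 1).ker := hT
  rw [Lp.ker_toTemperedDistributionCLM_eq_bot, Submodule.mem_bot] at hk
  exact (memLp_one_iff_integrable.2 hi).coeFn_toLp.symm.trans ((Lp.eq_zero_iff_ae_eq_zero).1 hk)

/-- If all matrix coefficients `⟨χ, T_Sch(g) ψ⟩` vanish, then one of the vectors is zero. -/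
theorem eq_zero_or_eq_zero_of_inner_tSch_eq_zero {ħ : ℝ} (hħ : 0 < ħ) {ψ χ : L2 (Conf N)}
    (h : ∀ g, inner ℂ χ (tSch ħ g ψ) = 0) : χ = 0 ∨ ψ = 0 := by
  have hshift : ∀ a : Conf N, MemLp (fun x => ψ (x - a)) 2 (volume : Measure (Conf N)) := fun a =>
    (Lp.memLp ψ).comp_measurePreserving (measurePreserving_sub_right volume a)
  have hae : ∀ a : Conf N, (fun x => ψ (x - a) * star (χ x)) =ᵐ[volume] 0 := by
    intro a
    refine ae_eq_zero_of_fourier_eq_zero ((hshift a).integrable_mul (Lp.memLp χ).star) fun w => ?_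
    -- The momentum `p₀ = -2πħ w` turns the coefficient into a Fourier integral at frequency `w`;
    -- the central component `½ p₀·a` cancels the constant phase `-½ p₀·x₀`.
    rw [← h ⟨(a, -((2 * Real.pi * ħ) • w)), 1 / 2 * inner ℝ (-((2 * Real.pi * ħ) • w)) a⟩,
      L2.inner_def, Real.fourier_eq']
    refine integral_congr_ae ?_
    filter_upwards [coeFn_tSch ħ
      ⟨(a, -((2 * Real.pi * ħ) • w)), 1 / 2 * inner ℝ (-((2 * Real.pi * ħ) • w)) a⟩ ψ] with x hx
    rw [hx, schAction]
    simp only [RCLike.inner_apply, smul_eq_mul, ← mul_assoc, starRingEnd_apply]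
    congr 4
    simp only [inner_neg_left, inner_smul_left, real_inner_comm]
    have : (ħ : ℂ) ≠ 0 := by exact_mod_cast hħ.ne'
    push_cast
    simp
    field_simp
  have hG : Integrable (fun y => ‖ψ (-y)‖ ^ 2) (volume : Measure (Conf N)) :=
    (integrable_norm_sq_L2 ψ).comp_neg
  -- At `a` the convolution of `|χ|²` with `|ψ(-·)|²` is `∫ |χ(x)|² |ψ(x - a)|² dx`, which vanishes
  -- by `hae`. Its total integral over `a` is `‖χ‖² ‖ψ‖²`.
  have hconv := integral_convolution (ContinuousLinearMap.mul ℝ ℝ) (integrable_norm_sq_L2 χ) hG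
  have hzero : ∀ a : Conf N, (convolution (fun x => ‖χ x‖ ^ 2) (fun y => ‖ψ (-y)‖ ^ 2)
      (ContinuousLinearMap.mul ℝ ℝ) volume) a = 0 := by
    intro a
    rw [convolution_def]
    refine integral_eq_zero_of_ae ?_
    filter_upwards [hae a] with x hx
    simp only [Pi.zero_apply, mul_eq_zero, star_eq_zero] at hx
    simp only [ContinuousLinearMap.mul_apply', neg_sub, Pi.zero_apply]
    rcases hx with hx | hx <;> simp [hx]
  simp_rw [hzero] at hconv
  rw [integral_zero, integral_neg_eq_self (fun y => ‖ψ y‖ ^ 2) volume,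
    ContinuousLinearMap.mul_apply', ← norm_sq_L2, ← norm_sq_L2] at hconv
  simpa using hconv.symm

theorem isIrreducibleUnitaryRep_tSch {ħ : ℝ} (hħ : 0 < ħ) [Nontrivial (L2 (Conf N))] :
    IsIrreducibleUnitaryRep (tSch (N := N) ħ) where
  strongly_continuous := continuous_tSch ħ
  nontrivial := inferInstance
  irreducible K hK hinv := by
    refine or_iff_not_imp_left.2 fun hbot => ?_
    obtain ⟨ψ, hψ, hψ0⟩ := Submodule.exists_mem_ne_zero_of_ne_bot hbot
    have : CompleteSpace K := hK.completeSpace_coe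
    -- Closedness makes `K` complete, so it suffices that `Kᗮ` is zero: any `χ` in it is orthogonal
    -- to the whole orbit of the nonzero vector `ψ`.
    rw [← Submodule.orthogonal_eq_bot_iff, Submodule.eq_bot_iff]
    intro χ hχ
    exact (eq_zero_or_eq_zero_of_inner_tSch_eq_zero hħ fun g =>
      Submodule.inner_left_of_mem_orthogonal (hinv g ψ hψ) hχ).resolve_right hψ0

theorem IsIrreducibleUnitaryRep.of_unitarilyEquivalent {H₁ H₂ : Type}
    [NormedAddCommGroup H₁] [InnerProductSpace ℂ H₁] [NormedAddCommGroup H₂]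
    [InnerProductSpace ℂ H₂] {π₁ : Heisenberg N →* (H₁ ≃ₗᵢ[ℂ] H₁)}
    {π₂ : Heisenberg N →* (H₂ ≃ₗᵢ[ℂ] H₂)} (h : IsIrreducibleUnitaryRep π₁)
    (he : UnitarilyEquivalent π₁ π₂) : IsIrreducibleUnitaryRep π₂ := by
  obtain ⟨W, hW⟩ := he
  refine ⟨fun v => ?_, ?_, fun K hK hinv => ?_⟩
  · have hc := W.continuous.comp (h.strongly_continuous (W.symm v))
    refine hc.congr fun g => ?_
    rw [Function.comp_apply, hW, W.apply_symm_apply]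
  · have := h.nontrivial
    exact W.toEquiv.symm.nontrivial
  · have hcomap := h.irreducible (K.comap W.toLinearEquiv.toLinearMap)
      (hK.preimage W.continuous) fun g v hv => by
        change W (π₁ g v) ∈ K
        rw [hW]
        exact hinv g _ hv
    refine hcomap.imp (fun hb => ?_) (fun ht => ?_)
    · rw [Submodule.eq_bot_iff] at hb ⊢
      intro v hv
      have := hb (W.symm v) (by change W (W.symm v) ∈ K; rwa [W.apply_symm_apply])
      simpa using this
    · rw [Submodule.eq_top_iff'] at ht ⊢
      intro v
      have : W (W.symm v) ∈ K := ht (W.symm v)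
      rwa [W.apply_symm_apply] at this

/-! ### Transfer to phase space and the Weyl operators. -/

section Intertwining

variable {ħ : ℝ} {φ : 𝓢(Conf N, ℂ)} {U : L2 (Conf N) →ₗᵢ[ℂ] L2 (Phase N)}

theorem tPh_intertwining (hU : ∀ ψ, U ψ =ᵐ[volume] wpt ħ φ ψ) (g : Heisenberg N)
    (ψ : L2 (Conf N)) : tPh ħ g (U ψ) = U (tSch ħ g ψ) := by
  refine Lp.ext ?_
  filter_upwards [coeFn_tPh ħ g (U ψ), hU (tSch ħ g ψ),
    (measurePreserving_sub_right volume g.z).quasiMeasurePreserving.ae (hU ψ)] with z h₁ h₂ h₃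
  rw [h₁, h₂, wpt_congr (coeFn_tSch ħ g ψ), ← phAction_wpt, phAction, phAction, h₃]

/-- The restriction of the phase-space representation to the range of the transform. -/
theorem exists_restriction (hħ : 0 < ħ) [Nontrivial (L2 (Conf N))]
    (hU : ∀ ψ, U ψ =ᵐ[volume] wpt ħ φ ψ) :
    ∃ ρ : Heisenberg N →*
        (LinearMap.range U.toLinearMap ≃ₗᵢ[ℂ] LinearMap.range U.toLinearMap),
      (∀ g Ψ, (ρ g Ψ : L2 (Phase N)) = tPh ħ g Ψ) ∧
      UnitarilyEquivalent (tSch ħ) ρ ∧ IsIrreducibleUnitaryRep ρ := by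
  let W : L2 (Conf N) ≃ₗᵢ[ℂ] LinearMap.range U.toLinearMap := U.equivRange
  have hW : ∀ ψ, (W ψ : L2 (Phase N)) = U ψ := fun ψ => rfl
  -- Defining `ρ` by conjugating `tSch` with `W` makes the homomorphism laws and the equivalence
  -- immediate. That it restricts `tPh`, and with it the invariance of the range, then follows from
  -- the intertwining.
  let ρ : Heisenberg N →* (LinearMap.range U.toLinearMap ≃ₗᵢ[ℂ] LinearMap.range U.toLinearMap) :=
    { toFun := fun g => (W.symm.trans (tSch ħ g)).trans W
      map_one' := by
        ext1 Ψ
        simp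
      map_mul' := fun g h => by
        ext1 Ψ
        simp }
  have hρ : ∀ g Ψ, ρ g Ψ = W (tSch ħ g (W.symm Ψ)) := fun g Ψ => rfl
  have he : UnitarilyEquivalent (tSch ħ) ρ :=
    ⟨W, fun g v => by rw [hρ, W.symm_apply_apply]⟩
  refine ⟨ρ, fun g Ψ => ?_, he, (isIrreducibleUnitaryRep_tSch hħ).of_unitarilyEquivalent he⟩
  rw [hρ, hW, ← tPh_intertwining hU, ← hW, W.apply_symm_apply]

theorem weylPh_wptSchwartz (hħ : 0 < ħ) (A : 𝓢'(Phase N, ℂ)) (ψ : 𝓢(Conf N, ℂ)) :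
    weylPh ħ hħ A (wptSchwartz ħ hħ φ ψ) = wptDist ħ φ (weylSch ħ hħ A ψ) := by
  ext z
  -- The two test functions on which `F_σ A` is evaluated coincide; the symbol plays no part in
  -- this.
  have h : phOrbit ħ (wptSchwartz ħ hħ φ ψ) z =
      ambiguityCLM ħ hħ ψ (wptKernelSchwartz ħ φ z) := by
    ext z₀
    rw [ambiguityCLM_apply]
    change phAction ħ ⟨z₀, 0⟩ (wpt ħ φ ψ) z = ∫ x, schAction ħ ⟨z₀, 0⟩ ψ x * wptKernel ħ φ z x
    rw [phAction_wpt, wpt_eq_integral_kernel]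
    simp_rw [mul_comm]
  rw [weylPh, h]
  rfl

theorem extension_intertwining (hħ : 0 < ħ) (hU : ∀ ψ, U ψ =ᵐ[volume] wpt ħ φ ψ)
    {A : 𝓢'(Phase N, ℂ)} {B : L2 (Conf N) →L[ℂ] L2 (Conf N)}
    {B' : L2 (Phase N) →L[ℂ] L2 (Phase N)}
    (hB : ∀ ψ χ : 𝓢(Conf N, ℂ), weylSch ħ hħ A ψ χ = ∫ x, B (ψ.toLp 2) x * χ x)
    (hB' : ∀ Ψ : 𝓢(Phase N, ℂ), B' (Ψ.toLp 2) =ᵐ[volume] weylPh ħ hħ A Ψ)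
    (ψ : L2 (Conf N)) : B' (U ψ) = U (B ψ) := by
  refine dense_schwartz.induction_on (p := fun ψ => B' (U ψ) = U (B ψ)) ψ
    (isClosed_eq (B'.continuous.comp U.continuous) (U.continuous.comp B.continuous)) fun ψ => ?_
  have hUψ : U (ψ.toLp 2) = (wptSchwartz ħ hħ φ ψ).toLp 2 := by
    refine Lp.ext ((hU _).trans ?_)
    rw [wpt_congr (ψ.coeFn_toLp 2 volume)]
    exact ((wptSchwartz ħ hħ φ ψ).coeFn_toLp 2 volume).symm
  rw [hUψ]
  refine Lp.ext ((hB' _).trans (.trans ?_ (hU _).symm))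
  rw [weylPh_wptSchwartz]
  refine Filter.Eventually.of_forall fun z => ?_
  -- Testing `A_Sch ψ` on the kernel `K_z` is, by `hB`, the integral of `B ψ` against `K_z`, that
  -- is, the transform of `B ψ` at `z`.
  rw [wptDist, hB, wpt_eq_integral_kernel]
  refine integral_congr_ae (Filter.Eventually.of_forall fun x => ?_)
  exact mul_comm _ _

theorem weylBochner_intertwining (hU : ∀ ψ, U ψ =ᵐ[volume] wpt ħ φ ψ) (A : Phase N → ℂ)
    (ψ : L2 (Conf N)) :
    weylBochner ħ (tPh ħ) A (U ψ) = U (weylBochner ħ (tSch ħ) A ψ) := by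
  simp_rw [weylBochner, tPh_intertwining hU, map_smul]
  congr 1
  -- A linear isometry preserves and reflects integrability, so it passes through the Bochner
  -- integral; a non-integrable integrand yields the default value `0` on both sides.
  refine Eq.trans ?_ (U.integral_comp_comm _)
  simp_rw [map_smul]
  rfl

end Intertwining

end PhaseSpaceWeyl

/-! ### The theorem. -/

theorem mainTheorem1 (N : ℕ) (ħ : ℝ) (hħ : 0 < ħ) (φ : 𝓢(Conf N, ℂ))
    (hφ : ∫ x, ‖φ x‖ ^ 2 = 1) :
    ∃ U : L2 (Conf N) →ₗᵢ[ℂ] L2 (Phase N),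
      -- `U` is the Wigner wave-packet transform with window `φ`
      (∀ ψ, U ψ =ᵐ[volume] wpt ħ φ ψ) ∧
      -- (i) intertwining of the representations
      (∀ g ψ, tPh ħ g (U ψ) = U (tSch ħ g ψ)) ∧
      -- the range of `U` is closed, and the phase-space representation restricts to a
      -- representation on it which is equivalent to the Schrödinger one and irreducible
      IsClosed (Set.range U) ∧
      (∃ ρ : Heisenberg N →*
          (LinearMap.range U.toLinearMap ≃ₗᵢ[ℂ] LinearMap.range U.toLinearMap),
        (∀ g Ψ, (ρ g Ψ : L2 (Phase N)) = tPh ħ g Ψ) ∧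
        UnitarilyEquivalent (tSch ħ) ρ ∧
        IsIrreducibleUnitaryRep ρ) ∧
      -- (ii) Weyl operators of tempered symbols, on Schwartz functions
      (∀ (A : 𝓢'(Phase N, ℂ)) (ψ : 𝓢(Conf N, ℂ)),
        weylPh ħ hħ A (wptSchwartz ħ hħ φ ψ) = wptDist ħ φ (weylSch ħ hħ A ψ)) ∧
      -- (ii) their extensions by continuity to bounded operators on `L²`
      (∀ (A : 𝓢'(Phase N, ℂ)) (B : L2 (Conf N) →L[ℂ] L2 (Conf N))
        (B' : L2 (Phase N) →L[ℂ] L2 (Phase N)),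
        (∀ ψ χ : 𝓢(Conf N, ℂ), weylSch ħ hħ A ψ χ = ∫ x, B (ψ.toLp 2) x * χ x) →
        (∀ Ψ : 𝓢(Phase N, ℂ), B' (Ψ.toLp 2) =ᵐ[volume] weylPh ħ hħ A Ψ) →
        ∀ ψ, B' (U ψ) = U (B ψ)) ∧
      -- (ii) Weyl operators given by Bochner integrals on `L²`
      (∀ A : Phase N → ℂ, Integrable A → Integrable (symplecticFourier ħ A) → ∀ ψ,
        weylBochner ħ (tPh ħ) A (U ψ) = U (weylBochner ħ (tSch ħ) A ψ)) := by
  obtain ⟨U, hU⟩ := exists_wptIsometry ħ hħ hφ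
  -- The normalised window is itself a nonzero vector, which supplies the nontriviality demanded of
  -- an irreducible representation.
  have hφ0 : φ.toLp 2 ≠ (0 : L2 (Conf N)) := fun h => by
    have h' := norm_toLp_sq φ
    rw [h, hφ] at h'
    simp at h'
  have : Nontrivial (L2 (Conf N)) := nontrivial_of_ne _ _ hφ0
  exact ⟨U, hU, tPh_intertwining hU, U.isometry.isClosedEmbedding.isClosed_range,
    exists_restriction hħ hU, weylPh_wptSchwartz hħ,
    fun _ _ _ hB hB' => extension_intertwining hħ hU hB hB',
    fun A _ _ => weylBochner_intertwining hU A⟩
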